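/- Let $k$ be an infinite field and let $\Delta$ be a finite quiver without oriented cycles, with set of vertices $\Delta_0$ and set of arrows $\Delta_1$; an arrow $\alpha$ goes from $s(\alpha)$ to $t(\alpha)$. In the path algebra $k\Delta$ the product $pq$ of two paths is the path "first $q$, then $p$" if $q$ ends where $p$ starts, and $0$ otherwise; $e_i$ is the trivial path at $i$. Let $\tilde\Delta$ be the double quiver, obtained from $\Delta$ by adding an arrow $\alpha^*:j\to i$ for each arrow $\alpha:i\to j$ of $\Delta$, and let $D$ be the quotient of $k\tilde\Delta$ by the relations $$\alpha^*\alpha=\sum_{\beta\in\Delta_1,\ t(\beta)=s(\alpha)}\beta\beta^*\quad(\alpha\in\Delta_1),\qquad \alpha^*\beta=0\quad(\alpha\ne\beta\in\Delta_1,\ t(\alpha)=t(\beta)).$$ All modules are left modules. For $d=(d_i)\in\mathbb N^{\Delta_0}$ let $P(d)=\bigoplus_{i}(k\Delta e_i)^{d_i}$. Let $\mathrm{Rep}(D,P(d))$ be the set of $D$-module structures on the vector space $P(d)$ which restrict to the given $k\Delta$-module structure, with the Zariski topology that it has as a subset of the space of representations of $\tilde\Delta$ on $P(d)$ (of tuples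 of linear maps indexed by the arrows of $\tilde\Delta$). The group $G(d)=\mathrm{Aut}_{k\Delta}P(d)$ acts on $\mathrm{Rep}(D,P(d))$ by conjugation. Let $X\in\mathrm{Rep}(D,P(d))$, that is, let $X$ be a $D$-module with ${}_{k\Delta}X=P(d)$. Then $$\dim_k\mathrm{End}_D X\ \ge\ \sum_{i\in\Delta_0}d_i^2.$$ Moreover, the following are equivalent: (i) the orbit $G(d)\cdot X$ is open in $\mathrm{Rep}(D,P(d))$; (ii) $X$ is rigid, that is, $\mathrm{Ext}^1_D(X,X)=0$; (iii) $\dim_k\mathrm{End}_D X=\sum_{i\in\Delta_0}d_i^2$. -/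

import Mathlib

open CategoryTheory

universe u v w

noncomputable section

namespace QuiverDouble

/-! ### The path algebra of a finite quiver -/

section PathAlgebra

variable (k : Type u) [Field k] (V : Type v) [Quiver.{w} V]

/-- All paths of a quiver: a path is a triple (start, end, path from start to end). -/
abbrev AllPaths := Σ i j : V, Quiver.Path i j

/-- The path algebra `kV`: the vector space with basis the set of all paths. -/
def PathAlgebra := AllPaths V →₀ k

namespace PathAlgebra

instance : AddCommGroup (PathAlgebra k V) := inferInstanceAs (AddCommGroup (AllPaths V →₀ k))

instance : Module k (PathAlgebra k V) := inferInstanceAs (Module k (AllPaths V →₀ k))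

/-- The basis of the path algebra given by the paths. -/
def basis : Module.Basis (AllPaths V) k (PathAlgebra k V) :=
  ⟨LinearEquiv.refl k (AllPaths V →₀ k)⟩

variable {V}

/-- A path, as a basis element of the path algebra. -/
def ofPath {i j : V} (p : Quiver.Path i j) : PathAlgebra k V := basis k V ⟨i, j, p⟩

open Classical in
/-- The product `pq` of two basis elements: first `q`, then `p`, if `q` ends where `p` starts,
and zero otherwise. -/
def mulPath (p q : AllPaths V) : PathAlgebra k V :=
  if h : q.2.1 = p.1 then ofPath k ((q.2.2.cast rfl h).comp p.2.2) else 0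

variable (V) in
/-- The bilinear extension of the product of paths. -/
def mulHom : PathAlgebra k V →ₗ[k] PathAlgebra k V →ₗ[k] PathAlgebra k V :=
  (basis k V).constr k fun p => (basis k V).constr k fun q => mulPath k p q

instance : Mul (PathAlgebra k V) := ⟨fun a b => mulHom k V a b⟩

/-- The unit is the sum of the trivial paths. -/
instance [Fintype V] : One (PathAlgebra k V) := ⟨∑ i : V, ofPath k (Quiver.Path.nil : Quiver.Path i i)⟩

theorem mul_def (a b : PathAlgebra k V) : a * b = mulHom k V a b := rfl

theorem one_def [Fintype V] :
    (1 : PathAlgebra k V) = ∑ i : V, ofPath k (Quiver.Path.nil : Quiver.Path i i) := rfl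

theorem mulHom_single (p q : AllPaths V) :
    mulHom k V (ofPath k p.2.2) (ofPath k q.2.2) = mulPath k p q := by
  simp only [mulHom, ofPath, Module.Basis.constr_basis]

theorem ofPath_mul_ofPath {i j l : V} (p : Quiver.Path j l) (q : Quiver.Path i j) :
    ofPath k p * ofPath k q = ofPath k (q.comp p) := by
  rw [mul_def]
  refine (mulHom_single k ⟨j, l, p⟩ ⟨i, j, q⟩).trans ?_
  simp [mulPath]

theorem ofPath_mul_ofPath_of_ne {i j j' l : V} (p : Quiver.Path j' l) (q : Quiver.Path i j)
    (h : j ≠ j') : ofPath k p * ofPath k q = 0 := by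
  rw [mul_def]
  refine (mulHom_single k ⟨j', l, p⟩ ⟨i, j, q⟩).trans ?_
  simp [mulPath, h]

/-- Induction on the basis of paths. -/
theorem induction {P : PathAlgebra k V → Prop} (a : PathAlgebra k V) (h0 : P 0)
    (hadd : ∀ a b, P a → P b → P (a + b))
    (hs : ∀ (c : k) {i j : V} (p : Quiver.Path i j), P (c • ofPath k p)) : P a := by
  rw [← (basis k V).linearCombination_repr a]
  generalize (basis k V).repr a = f
  induction f using Finsupp.induction_linear with
  | zero => rwa [map_zero]
  | add f g hf hg => rw [map_add]; exact hadd _ _ hf hg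
  | single p c => rw [Finsupp.linearCombination_single]; exact hs c p.2.2

protected theorem add_mul' (a b c : PathAlgebra k V) : (a + b) * c = a * c + b * c := by
  simp [mul_def]

protected theorem mul_add' (a b c : PathAlgebra k V) : a * (b + c) = a * b + a * c := by
  simp [mul_def]

protected theorem smul_mul' (r : k) (a b : PathAlgebra k V) : (r • a) * b = r • (a * b) := by
  simp [mul_def]

protected theorem mul_smul' (r : k) (a b : PathAlgebra k V) : a * (r • b) = r • (a * b) := by
  simp [mul_def]

protected theorem zero_mul' (a : PathAlgebra k V) : 0 * a = 0 := by simp [mul_def]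

protected theorem mul_zero' (a : PathAlgebra k V) : a * 0 = 0 := by simp [mul_def]

protected theorem mul_assoc' (a b c : PathAlgebra k V) : a * b * c = a * (b * c) := by
  induction a using induction with
  | h0 => simp only [PathAlgebra.zero_mul']
  | hadd a a' ha ha' => simp only [PathAlgebra.add_mul', ha, ha']
  | @hs r i j p =>
    induction b using induction with
    | h0 => simp only [PathAlgebra.zero_mul', PathAlgebra.mul_zero']
    | hadd b b' hb hb' => simp only [PathAlgebra.add_mul', PathAlgebra.mul_add', hb, hb']
    | @hs s i' j' q =>
      induction c using induction with
      | h0 => simp only [PathAlgebra.mul_zero']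
      | hadd c c' hc hc' => simp only [PathAlgebra.mul_add', hc, hc']
      | @hs t i'' j'' x =>
        simp only [PathAlgebra.smul_mul', PathAlgebra.mul_smul']
        congr 3
        by_cases h : j' = i
        · subst h
          by_cases h' : j'' = i'
          · subst h'
            simp only [ofPath_mul_ofPath, Quiver.Path.comp_assoc]
          · simp only [ofPath_mul_ofPath, ofPath_mul_ofPath_of_ne k _ _ h', PathAlgebra.mul_zero']
        · by_cases h' : j'' = i'
          · subst h'
            simp only [ofPath_mul_ofPath, ofPath_mul_ofPath_of_ne k _ _ h, PathAlgebra.zero_mul']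
          · simp only [ofPath_mul_ofPath_of_ne k _ _ h, ofPath_mul_ofPath_of_ne k _ _ h',
              PathAlgebra.zero_mul', PathAlgebra.mul_zero']

protected theorem one_mul' [Fintype V] (a : PathAlgebra k V) : 1 * a = a := by
  induction a using induction with
  | h0 => simp only [PathAlgebra.mul_zero']
  | hadd a a' ha ha' => simp only [PathAlgebra.mul_add', ha, ha']
  | @hs r i j p =>
    rw [PathAlgebra.mul_smul', one_def, mul_def, map_sum, LinearMap.sum_apply]
    congr 1
    rw [Finset.sum_eq_single j]
    · rw [← mul_def, ofPath_mul_ofPath, Quiver.Path.comp_nil]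
    · intro l _ hl
      rw [← mul_def, ofPath_mul_ofPath_of_ne k _ _ hl.symm]
    · simp

protected theorem mul_one' [Fintype V] (a : PathAlgebra k V) : a * 1 = a := by
  induction a using induction with
  | h0 => simp only [PathAlgebra.zero_mul']
  | hadd a a' ha ha' => simp only [PathAlgebra.add_mul', ha, ha']
  | @hs r i j p =>
    rw [PathAlgebra.smul_mul', one_def, mul_def, map_sum]
    congr 1
    rw [Finset.sum_eq_single i]
    · rw [← mul_def, ofPath_mul_ofPath, Quiver.Path.nil_comp]
    · intro l _ hl
      rw [← mul_def, ofPath_mul_ofPath_of_ne k _ _ hl]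
    · simp

instance [Fintype V] : Ring (PathAlgebra k V) :=
  { (inferInstance : AddCommGroup (PathAlgebra k V)),
    (inferInstance : Mul (PathAlgebra k V)),
    (inferInstance : One (PathAlgebra k V)) with
    left_distrib := PathAlgebra.mul_add' k
    right_distrib := PathAlgebra.add_mul' k
    zero_mul := PathAlgebra.zero_mul' k
    mul_zero := PathAlgebra.mul_zero' k
    mul_assoc := PathAlgebra.mul_assoc' k
    one_mul := PathAlgebra.one_mul' k
    mul_one := PathAlgebra.mul_one' k }

instance [Fintype V] : Algebra k (PathAlgebra k V) :=
  Algebra.ofModule (PathAlgebra.smul_mul' k) (PathAlgebra.mul_smul' k)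

/-- The trivial path `e_i`. -/
def vertex (i : V) : PathAlgebra k V := ofPath k (Quiver.Path.nil : Quiver.Path i i)

/-- An arrow, as an element of the path algebra. -/
def arrow {i j : V} (a : i ⟶ j) : PathAlgebra k V := ofPath k a.toPath

end PathAlgebra

/-- The projective `kV`-module `P(d) = ⨁_i (kV e_i)^{d_i}`, where `kV e_i` is the left ideal
generated by the trivial path at `i`. -/
abbrev ProjModule [Fintype V] (d : V → ℕ) : Type (max u v w) :=
  ∀ i : V, Fin (d i) →
    (Submodule.span (PathAlgebra k V) {PathAlgebra.vertex k i} :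
      Submodule (PathAlgebra k V) (PathAlgebra k V))

end PathAlgebra

/-! ### The algebra `D` of the double quiver with relations -/

section Inclusion

variable (k : Type u) [Field k] {V : Type v} [Quiver.{w} V]

variable (V) in
/-- The linear map from `kV` to the path algebra of the double quiver which sends a path to
itself. -/
def inclLin : PathAlgebra k V →ₗ[k] PathAlgebra k (Quiver.Symmetrify V) :=
  (PathAlgebra.basis k V).constr k
    fun p => PathAlgebra.ofPath k (Quiver.Symmetrify.of.mapPath p.2.2)

theorem inclLin_ofPath {i j : V} (p : Quiver.Path i j) :
    inclLin k V (PathAlgebra.ofPath k p) =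
      PathAlgebra.ofPath k (Quiver.Symmetrify.of.mapPath p) := by
  rw [inclLin, PathAlgebra.ofPath, Module.Basis.constr_basis]

end Inclusion

section Double

variable (k : Type u) [Field k] (V : Type v) [Quiver.{w} V] [Fintype V]

instance : Fintype (Quiver.Symmetrify V) := inferInstanceAs (Fintype V)

variable {V}

/-- The arrow `a` of the quiver, in the path algebra of the double quiver. -/
def dblArrow {i j : V} (a : i ⟶ j) : PathAlgebra k (Quiver.Symmetrify V) :=
  PathAlgebra.arrow k (V := Quiver.Symmetrify V) (i := i) (j := j) (Sum.inl a)

/-- The opposite arrow `a^* : j ⟶ i` of an arrow `a : i ⟶ j`, in the path algebra of the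
double quiver. -/
def dblStar {i j : V} (a : i ⟶ j) : PathAlgebra k (Quiver.Symmetrify V) :=
  PathAlgebra.arrow k (V := Quiver.Symmetrify V) (i := j) (j := i) (Sum.inr a)

variable (V) in
/-- The algebra homomorphism from `kV` to the path algebra of the double quiver. -/
def incl : PathAlgebra k V →ₐ[k] PathAlgebra k (Quiver.Symmetrify V) :=
  AlgHom.ofLinearMap (inclLin k V)
    (by
      rw [PathAlgebra.one_def, map_sum]
      simp only [inclLin_ofPath, Prefunctor.mapPath_nil]
      rfl)
    (by
      intro a b
      induction a using PathAlgebra.induction with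
      | h0 => simp
      | hadd a a' ha ha' => simp only [add_mul, map_add, ha, ha']
      | @hs r i j p =>
        induction b using PathAlgebra.induction with
        | h0 => simp
        | hadd b b' hb hb' => simp only [mul_add, map_add, hb, hb']
        | @hs s i' j' q =>
          simp only [smul_mul_assoc, mul_smul_comm, map_smul]
          congr 2
          by_cases h : j' = i
          · subst h
            simp only [PathAlgebra.ofPath_mul_ofPath, inclLin_ofPath, Prefunctor.mapPath_comp]
          · rw [PathAlgebra.ofPath_mul_ofPath_of_ne k _ _ h, map_zero, inclLin_ofPath,
              inclLin_ofPath]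
            exact (PathAlgebra.ofPath_mul_ofPath_of_ne k (V := Quiver.Symmetrify V) _ _ h).symm)

variable (V) in
/-- The defining relations of `D`:
`a^* a = ∑_{t(b) = s(a)} b b^*` for each arrow `a`, and `a^* b = 0` for two different
arrows `a`, `b` ending at the same vertex. -/
inductive DoubleRel [∀ i j : V, Fintype (i ⟶ j)] :
    PathAlgebra k (Quiver.Symmetrify V) → PathAlgebra k (Quiver.Symmetrify V) → Prop
  | comm {i j : V} (a : i ⟶ j) :
      DoubleRel (dblStar k a * dblArrow k a)
        (∑ h : V, ∑ b : h ⟶ i, dblArrow k b * dblStar k b)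
  | zero {i h j : V} (a : i ⟶ j) (b : h ⟶ j)
      (hab : (⟨i, a⟩ : Σ l : V, (l ⟶ j)) ≠ ⟨h, b⟩) :
      DoubleRel (dblStar k a * dblArrow k b) 0

variable [∀ i j : V, Fintype (i ⟶ j)]

variable (V) in
/-- The algebra `D`: the path algebra of the double quiver modulo the defining relations. -/
abbrev DoubleAlgebra : Type (max u v w) := RingQuot (DoubleRel k V)

/-- The canonical map from the path algebra of the double quiver to `D`. -/
abbrev toDouble : PathAlgebra k (Quiver.Symmetrify V) →ₐ[k] DoubleAlgebra k V :=
  RingQuot.mkAlgHom k (DoubleRel k V)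

variable (V) in
/-- The canonical algebra homomorphism `kV → D`. -/
def ofPathAlgebra : PathAlgebra k V →ₐ[k] DoubleAlgebra k V := (toDouble k).comp (incl k V)

end Double

/-! ### The Zariski topology of a finite-dimensional vector space -/

section Zariski

variable (k : Type u) [Field k] (E : Type v) [AddCommGroup E] [Module k E]

/-- The polynomial functions on a vector space: the algebra of functions generated by the linear
forms. -/
def polynomialFunctions : Subalgebra k (E → k) :=
  Algebra.adjoin k (Set.range fun (φ : Module.Dual k E) (x : E) => φ x)

/-- The Zariski topology on (the `k`-points of) a finite-dimensional vector space, with basis of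
open sets the complements of the zero sets of polynomial functions. -/
@[reducible] def zariskiTopology : TopologicalSpace E :=
  TopologicalSpace.generateFrom
    {U | ∃ f ∈ polynomialFunctions k E, U = {x | f x ≠ 0}}

end Zariski

/-! ### The variety `Rep(D, P(d))` and the action of `G(d) = Aut P(d)` -/

section Rep

variable (k : Type u) [Field k] (V : Type v) [Quiver.{w} V] [Fintype V]
  [∀ i j : V, Fintype (i ⟶ j)] (d : V → ℕ)

/-- `Rep(D, P(d))`: the `D`-module structures on the vector space `P(d)` whose restriction to the
path algebra `kV` is the given module structure of `P(d)`. -/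
@[ext]
structure Rep where
  /-- the action of `D` -/
  toAlgHom : DoubleAlgebra k V →ₐ[k] Module.End k (ProjModule k V d)
  restrict : ∀ (a : PathAlgebra k V) (x : ProjModule k V d),
    toAlgHom (ofPathAlgebra k V a) x = a • x

/-- `G(d) = Aut P(d)`, the group of `kV`-linear automorphisms of `P(d)`. -/
abbrev AutGroup := ProjModule k V d ≃ₗ[PathAlgebra k V] ProjModule k V d

namespace Rep

variable {k V d}

/-- `G(d)` acts on `Rep(D, P(d))` by conjugation, `(g • X)(a) = g X(a) g⁻¹`. -/
instance : MulAction (AutGroup k V d) (Rep k V d) where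
  smul g X :=
    { toAlgHom := (LinearEquiv.conjAlgEquiv k (g.restrictScalars k)).toAlgHom.comp X.toAlgHom
      restrict := fun a x => by
        change g (X.toAlgHom (ofPathAlgebra k V a) (g.symm x)) = a • x
        rw [X.restrict, map_smul, LinearEquiv.apply_symm_apply] }
  one_smul X := by
    ext a x
    rfl
  mul_smul g h X := by
    ext a x
    rfl

theorem smul_apply (g : AutGroup k V d) (X : Rep k V d) (a : DoubleAlgebra k V)
    (x : ProjModule k V d) : (g • X).toAlgHom a x = g (X.toAlgHom a (g⁻¹ x)) := rfl

variable (k V d) in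
/-- The ambient vector space of `Rep(D, P(d))`: a linear map for each arrow of the double
quiver. -/
abbrev Ambient :=
  ∀ i j : Quiver.Symmetrify V, (i ⟶ j) → Module.End k (ProjModule k V d)

/-- The representation of the double quiver given by a point of `Rep(D, P(d))`. -/
def coords (X : Rep k V d) : Ambient k V d :=
  fun _ _ a => X.toAlgHom (toDouble k (PathAlgebra.arrow k a))

/-- `Rep(D, P(d))` has the subspace topology of the Zariski topology. -/
instance : TopologicalSpace (Rep k V d) :=
  (zariskiTopology k (Ambient k V d)).induced coords

/-- The `D`-module given by a point of `Rep(D, P(d))`. -/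
def Mod (_ : Rep k V d) : Type (max u v w) := ProjModule k V d

variable (X : Rep k V d)

instance : AddCommGroup X.Mod := inferInstanceAs (AddCommGroup (ProjModule k V d))

instance : Module k X.Mod := inferInstanceAs (Module k (ProjModule k V d))

instance : Module (DoubleAlgebra k V) X.Mod :=
  Module.compHom (ProjModule k V d) X.toAlgHom.toRingHom

instance : IsScalarTower k (DoubleAlgebra k V) X.Mod where
  smul_assoc c a x := by
    change X.toAlgHom (c • a) x = c • X.toAlgHom a x
    rw [map_smul]
    rfl

/-- `X` is rigid: `Ext^1_D(X, X) = 0`. -/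
def IsRigid : Prop :=
  Subsingleton (Abelian.Ext (ModuleCat.of (DoubleAlgebra k V) X.Mod)
    (ModuleCat.of (DoubleAlgebra k V) X.Mod) 1)

/-- The algebra `End_D X`. -/
abbrev EndD := Module.End (DoubleAlgebra k V) X.Mod

end Rep

end Rep

end QuiverDouble

end

noncomputable section

set_option linter.unusedSectionVars false

/-! With the `kΔ`-action on `P = P(d)` fixed, the relations of `D` are linear and homogeneous in the
maps `σ_a` by which the `a^*` act. So `Rep(D, P)` is a vector space, `StarMaps`.

Dimension count. For `σ` in this space, `θ = ∑ a σ_a` is a `kΔ`-endomorphism of `P`: the relations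
of `D` give precisely its compatibility with arrows. Its image lies in the part of `P` spanned by
nontrivial paths. Conversely, if `θ` has image there, every `θ(x)` is uniquely `∑ a y_a` with `y_a`
in `e_{s(a)} P`, and `σ_a(x) = y_a` recovers the family. Endomorphisms of `P` act on its top by
arbitrary tuples of square matrices of sizes `d_i`, so `dim End P = ∑ d_i² + dim StarMaps`
(`ProjModule.starMapsEquiv`, `ProjModule.finrank_end`).

The commutator. The kernel of `delta σ σ : g ↦ σ g - g σ`, from `End P` to `StarMaps`, is `End_D X`.
Rank-nullity gives the inequality, with equality if and only if `delta σ σ` is surjective.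
Conditions (i) and (ii) are each compared with this surjectivity.

Rigidity. Since `X` is projective over `kΔ`, surjections onto it split over `kΔ`, so its
self-extensions are governed by star families `η` modulo commutators
(`isRigid_iff_delta_surjective`).

Open orbit. No differential of the orbit map is used, so neither separability nor algebraic
closedness matters. If the orbit is open, cofinitely many points `σ + tη` of a line are conjugate to
`σ`; at those `t` the pencil `delta σ (σ + tη) = delta σ σ + t (g ↦ η g)` has rank at most its rank
at `0`. Then `g ↦ η g` maps the kernel at `0` into the range at `0` (`mem_range_of_pencil`), and the
identity, which is in that kernel, is sent to `η`. Conversely, if `delta σ σ` is onto, Cramer's rule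
continues the identity to a polynomial family `g(τ)` in the kernels of `delta σ τ`; wherever `det
g(τ) ≠ 0`, it conjugates `σ` to `τ` (`exists_polynomial_kernel`). -/

namespace QuiverDouble

/-! ### Generators, relations and the universal property of the path algebra -/

section Generators

variable {k : Type u} [Field k] {V : Type v} [Quiver.{w} V]

namespace PathAlgebra

theorem vertex_mul_ofPath {i j : V} (p : Quiver.Path i j) :
    vertex k j * ofPath k p = ofPath k p := by
  rw [vertex, ofPath_mul_ofPath, Quiver.Path.comp_nil]

theorem ofPath_mul_vertex {i j : V} (p : Quiver.Path i j) :
    ofPath k p * vertex k i = ofPath k p := by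
  rw [vertex, ofPath_mul_ofPath, Quiver.Path.nil_comp]

theorem arrow_mul_ofPath {i j l : V} (p : Quiver.Path i j) (a : j ⟶ l) :
    arrow k a * ofPath k p = ofPath k (p.cons a) := by
  rw [arrow, ofPath_mul_ofPath]; rfl

theorem vertex_mul_vertex_of_ne {i j : V} (h : i ≠ j) : vertex k i * vertex k j = 0 :=
  ofPath_mul_ofPath_of_ne k _ _ h.symm

theorem vertex_mul_arrow {i j : V} (a : i ⟶ j) : vertex k j * arrow k a = arrow k a :=
  vertex_mul_ofPath _

theorem arrow_mul_vertex {i j : V} (a : i ⟶ j) : arrow k a * vertex k i = arrow k a :=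
  ofPath_mul_vertex _

theorem vertex_mul_arrow_of_ne {i j l : V} (a : i ⟶ j) (h : l ≠ j) :
    vertex k l * arrow k a = 0 :=
  ofPath_mul_ofPath_of_ne k _ _ h.symm

theorem vertex_mul_self (i : V) : vertex k i * vertex k i = vertex k i :=
  vertex_mul_ofPath _

theorem sum_vertex [Fintype V] : ∑ i : V, vertex k i = 1 := rfl

/-- A path algebra element lies in any subalgebra containing the trivial paths and the arrows. -/
theorem mem_of_generators [Fintype V] (S : Subalgebra k (PathAlgebra k V))
    (hv : ∀ i : V, vertex k i ∈ S) (ha : ∀ (i j : V) (a : i ⟶ j), arrow k a ∈ S)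
    (x : PathAlgebra k V) : x ∈ S := by
  induction x using PathAlgebra.induction with
  | h0 => exact S.zero_mem
  | hadd a b ha hb => exact S.add_mem ha hb
  | @hs c i j p =>
    refine S.smul_mem ?_ c
    induction p with
    | nil => exact hv i
    | cons p a ih => rw [← arrow_mul_ofPath]; exact S.mul_mem (ha _ _ a) ih

section Lift

variable {R : Type*} [Ring R] [Algebra k R] (ε : V → R) (ρ : ∀ i j : V, (i ⟶ j) → R)

/-- The product of the values of `ρ` along a path. -/
def evalPath {i : V} : ∀ {j : V}, Quiver.Path i j → R
  | _, .nil => ε i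
  | _, .cons p a => ρ _ _ a * evalPath p

variable {ε ρ} (hε : ∀ i, ε i * ε i = ε i) (hne : ∀ i j, i ≠ j → ε i * ε j = 0)
  (hl : ∀ i j (a : i ⟶ j), ε j * ρ i j a = ρ i j a)
  (hr : ∀ i j (a : i ⟶ j), ρ i j a * ε i = ρ i j a)

include hε hl in
theorem mul_evalPath {i j : V} (p : Quiver.Path i j) :
    ε j * evalPath ε ρ p = evalPath ε ρ p := by
  cases p with
  | nil => exact hε i
  | cons p a => rw [evalPath, ← mul_assoc, hl]

include hε in
theorem evalPath_mul {i j : V} (p : Quiver.Path i j) :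
    evalPath ε ρ p * ε i = evalPath ε ρ p := by
  induction p with
  | nil => exact hε i
  | cons p a ih => rw [evalPath, mul_assoc, ih]

include hε hl in
theorem evalPath_comp {i j l : V} (p : Quiver.Path i j) (q : Quiver.Path j l) :
    evalPath ε ρ (p.comp q) = evalPath ε ρ q * evalPath ε ρ p := by
  induction q with
  | nil => exact (mul_evalPath hε hl p).symm
  | cons q a ih => rw [Quiver.Path.comp_cons, evalPath, ih, evalPath, mul_assoc]

include hε hne hl in
theorem evalPath_mul_of_ne {i j i' j' : V} (p : Quiver.Path i j) (q : Quiver.Path i' j')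
    (h : j' ≠ i) : evalPath ε ρ p * evalPath ε ρ q = 0 := by
  rw [← evalPath_mul hε p, ← mul_evalPath hε hl q, mul_assoc, ← mul_assoc (ε i),
    hne _ _ h.symm, zero_mul, mul_zero]

/-- The universal property of the path algebra. -/
def lift [Fintype V] (hone : ∑ i, ε i = 1) : PathAlgebra k V →ₐ[k] R :=
  AlgHom.ofLinearMap ((basis k V).constr k fun p => evalPath ε ρ p.2.2)
    (by
      rw [one_def, map_sum, ← hone]
      exact Finset.sum_congr rfl fun i _ => by
        rw [ofPath, Module.Basis.constr_basis]; rfl)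
    (by
      have key {i j : V} (p : Quiver.Path i j) :
          (basis k V).constr k (fun p => evalPath ε ρ p.2.2) (ofPath k p) = evalPath ε ρ p := by
        rw [ofPath, Module.Basis.constr_basis]
      intro a b
      induction a using PathAlgebra.induction with
      | h0 => simp
      | hadd a a' ha ha' => simp only [add_mul, map_add, ha, ha']
      | @hs r i j p =>
        induction b using PathAlgebra.induction with
        | h0 => simp
        | hadd b b' hb hb' => simp only [mul_add, map_add, hb, hb']
        | @hs s i' j' q =>
          simp only [smul_mul_assoc, mul_smul_comm, map_smul]
          congr 2
          by_cases h : j' = i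
          · subst h
            rw [ofPath_mul_ofPath, key, key, key, evalPath_comp hε hl]
          · rw [ofPath_mul_ofPath_of_ne k _ _ h, map_zero, key, key,
              evalPath_mul_of_ne hε hne hl _ _ h])

theorem lift_ofPath [Fintype V] (hone : ∑ i, ε i = 1) {i j : V} (p : Quiver.Path i j) :
    lift (k := k) hε hne hl hone (ofPath k p) = evalPath ε ρ p := by
  change (basis k V).constr k (fun p => evalPath ε ρ p.2.2) (ofPath k p) = _
  rw [ofPath, Module.Basis.constr_basis]

theorem lift_vertex [Fintype V] (hone : ∑ i, ε i = 1) (i : V) :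
    lift (k := k) hε hne hl hone (vertex k i) = ε i :=
  lift_ofPath hε hne hl hone _

-- `evalPath` starts with the idempotent of the source, so an arrow goes to `ρ a * ε i`.
-- Multiplicativity of `lift` does not need `hr`; only this evaluation does.
include hr in
theorem lift_arrow [Fintype V] (hone : ∑ i, ε i = 1) {i j : V} (a : i ⟶ j) :
    lift (k := k) hε hne hl hone (arrow k a) = ρ i j a :=
  (lift_ofPath hε hne hl hone _).trans (hr _ _ _)

end Lift

end PathAlgebra

open PathAlgebra

theorem incl_arrow [Fintype V] {i j : V} (a : i ⟶ j) : incl k V (arrow k a) = dblArrow k a :=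
  inclLin_ofPath k _

theorem incl_vertex [Fintype V] (i : V) :
    incl k V (vertex k i) = vertex k (V := Quiver.Symmetrify V) i :=
  inclLin_ofPath k _

variable [Fintype V] [∀ i j : V, Fintype (i ⟶ j)]

theorem ofPathAlgebra_vertex (i : V) :
    ofPathAlgebra k V (vertex k i) =
      toDouble k (vertex k (V := Quiver.Symmetrify V) i) :=
  congrArg (toDouble k) (incl_vertex i)

theorem ofPathAlgebra_arrow {i j : V} (a : i ⟶ j) :
    ofPathAlgebra k V (arrow k a) = toDouble k (dblArrow k a) :=
  congrArg (toDouble k) (incl_arrow a)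

theorem toDouble_surjective : Function.Surjective (toDouble (V := V) k) :=
  RingQuot.mkAlgHom_surjective k (DoubleRel k V)

/-- The element `a^*` of the algebra `D`. -/
def star {i j : V} (a : i ⟶ j) : DoubleAlgebra k V := toDouble k (dblStar k a)

/-- The algebra `D` is generated by the path algebra and the elements `a^*`. -/
theorem mem_of_ofPathAlgebra_of_star (S : Subalgebra k (DoubleAlgebra k V))
    (hp : ∀ a : PathAlgebra k V, ofPathAlgebra k V a ∈ S)
    (hs : ∀ (i j : V) (a : i ⟶ j), star (k := k) a ∈ S) (x : DoubleAlgebra k V) : x ∈ S := by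
  obtain ⟨x, rfl⟩ := toDouble_surjective x
  refine mem_of_generators (S.comap (toDouble k)) (fun i => ?_) (fun i j a => ?_) x
  · exact (Subalgebra.mem_comap ..).2 (Set.mem_of_eq_of_mem (ofPathAlgebra_vertex (V := V) i).symm (hp _))
  · rcases a with a | a
    · exact (Subalgebra.mem_comap ..).2 (Set.mem_of_eq_of_mem (ofPathAlgebra_arrow (V := V) a).symm (hp _))
    · exact hs _ _ a

theorem vertex_mul_star {i j : V} (a : i ⟶ j) :
    ofPathAlgebra k V (vertex k i) * star a = star a := by
  rw [ofPathAlgebra_vertex, star, ← map_mul]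
  exact congrArg (toDouble k) (vertex_mul_arrow (V := Quiver.Symmetrify V) (Sum.inr a))

theorem star_mul_vertex {i j : V} (a : i ⟶ j) :
    star a * ofPathAlgebra k V (vertex k j) = star a := by
  rw [ofPathAlgebra_vertex, star, ← map_mul]
  exact congrArg (toDouble k) (arrow_mul_vertex (V := Quiver.Symmetrify V) (Sum.inr a))

theorem star_mul_arrow_self {i j : V} (a : i ⟶ j) :
    star a * ofPathAlgebra k V (arrow k a) =
      ∑ h : V, ∑ b : h ⟶ i, ofPathAlgebra k V (arrow k b) * star b := by
  simp only [ofPathAlgebra_arrow, star, ← map_mul, ← map_sum]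
  exact RingQuot.mkAlgHom_rel k (DoubleRel.comm a)

theorem star_mul_arrow_of_ne {i h j : V} (a : i ⟶ j) (b : h ⟶ j)
    (hab : (⟨i, a⟩ : Σ l : V, (l ⟶ j)) ≠ ⟨h, b⟩) :
    star a * ofPathAlgebra k V (arrow k b) = 0 := by
  simp only [ofPathAlgebra_arrow, star, ← map_mul]
  exact (RingQuot.mkAlgHom_rel k (DoubleRel.zero a b hab)).trans (map_zero _)

end Generators

/-! ### The linear space of actions of the `a^*` on a fixed `kΔ`-module -/

section StarMaps

open PathAlgebra

variable (k : Type u) [Field k] (V : Type v) [Quiver.{w} V] [Fintype V]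
  [∀ i j : V, Fintype (i ⟶ j)]
  (M N L : Type*)
  [AddCommGroup M] [Module k M] [Module (PathAlgebra k V) M] [IsScalarTower k (PathAlgebra k V) M]
  [AddCommGroup N] [Module k N] [Module (PathAlgebra k V) N] [IsScalarTower k (PathAlgebra k V) N]
  [AddCommGroup L] [Module k L] [Module (PathAlgebra k V) L] [IsScalarTower k (PathAlgebra k V) L]

/-- The families of linear maps `M → N`, indexed by the arrows, which satisfy the linear relations
that the actions of the elements `a^*` satisfy in a `D`-module. -/
def StarMaps : Submodule k (∀ i j : V, (i ⟶ j) → (M →ₗ[k] N)) where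
  carrier := {σ |
    (∀ i j (a : i ⟶ j) x, vertex k i • σ i j a x = σ i j a x) ∧
    (∀ i j (a : i ⟶ j) x, σ i j a (vertex k j • x) = σ i j a x) ∧
    (∀ i j (a : i ⟶ j) x,
      σ i j a (arrow k a • x) = ∑ h : V, ∑ b : h ⟶ i, arrow k b • σ h i b x) ∧
    (∀ i h j (a : i ⟶ j) (b : h ⟶ j), (⟨i, a⟩ : Σ l : V, (l ⟶ j)) ≠ ⟨h, b⟩ →
      ∀ x, σ i j a (arrow k b • x) = 0)}
  add_mem' := by
    rintro σ τ ⟨h1, h2, h3, h4⟩ ⟨g1, g2, g3, g4⟩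
    refine ⟨fun i j a x => ?_, fun i j a x => ?_, fun i j a x => ?_, fun i h j a b hab x => ?_⟩
    · simp [h1, g1]
    · simp [h2, g2]
    · simp [h3, g3, Finset.sum_add_distrib]
    · simp [h4 _ _ _ _ _ hab, g4 _ _ _ _ _ hab]
  zero_mem' := by simp
  smul_mem' := by
    rintro c σ ⟨h1, h2, h3, h4⟩
    refine ⟨fun i j a x => ?_, fun i j a x => ?_, fun i j a x => ?_, fun i h j a b hab x => ?_⟩
    · simp [h1, smul_comm _ c]
    · simp [h2]
    · simp [h3, Finset.smul_sum, smul_comm _ c]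
    · simp [h4 _ _ _ _ _ hab]

namespace StarMaps

variable {k V M N L}

theorem vertex_smul (σ : StarMaps k V M N) {i j : V} (a : i ⟶ j) (x : M) :
    vertex k i • σ.1 i j a x = σ.1 i j a x := σ.2.1 i j a x

theorem apply_vertex_smul (σ : StarMaps k V M N) {i j : V} (a : i ⟶ j) (x : M) :
    σ.1 i j a (vertex k j • x) = σ.1 i j a x := σ.2.2.1 i j a x

theorem apply_arrow_smul (σ : StarMaps k V M N) {i j : V} (a : i ⟶ j) (x : M) :
    σ.1 i j a (arrow k a • x) = ∑ h : V, ∑ b : h ⟶ i, arrow k b • σ.1 h i b x :=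
  σ.2.2.2.1 i j a x

theorem apply_arrow_smul_of_ne (σ : StarMaps k V M N) {i h j : V} (a : i ⟶ j) (b : h ⟶ j)
    (hab : (⟨i, a⟩ : Σ l : V, (l ⟶ j)) ≠ ⟨h, b⟩) (x : M) : σ.1 i j a (arrow k b • x) = 0 :=
  σ.2.2.2.2 i h j a b hab x

/-- Composition of a family of star maps with a `kV`-linear map on the left. -/
def postcomp (g : N →ₗ[PathAlgebra k V] L) (σ : StarMaps k V M N) : StarMaps k V M L :=
  ⟨fun i j a => g.restrictScalars k ∘ₗ σ.1 i j a, by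
    refine ⟨fun i j a x => ?_, fun i j a x => ?_, fun i j a x => ?_, fun i h j a b hab x => ?_⟩
    · rw [LinearMap.comp_apply, LinearMap.restrictScalars_apply, ← map_smul, vertex_smul]
    · simp [apply_vertex_smul]
    · simp [apply_arrow_smul, map_sum]
    · simp [apply_arrow_smul_of_ne _ _ _ hab]⟩

/-- Composition of a family of star maps with a `kV`-linear map on the right. -/
def precomp (σ : StarMaps k V N L) (g : M →ₗ[PathAlgebra k V] N) : StarMaps k V M L :=
  ⟨fun i j a => σ.1 i j a ∘ₗ g.restrictScalars k, by
    refine ⟨fun i j a x => ?_, fun i j a x => ?_, fun i j a x => ?_, fun i h j a b hab x => ?_⟩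
    · simp [vertex_smul]
    · simp [apply_vertex_smul]
    · simp [apply_arrow_smul]
    · simp [apply_arrow_smul_of_ne _ _ _ hab]⟩

theorem postcomp_apply (g : N →ₗ[PathAlgebra k V] L) (σ : StarMaps k V M N) {i j : V}
    (a : i ⟶ j) (x : M) : (postcomp g σ).1 i j a x = g (σ.1 i j a x) := rfl

theorem precomp_apply (σ : StarMaps k V N L) (g : M →ₗ[PathAlgebra k V] N) {i j : V}
    (a : i ⟶ j) (x : M) : (precomp σ g).1 i j a x = σ.1 i j a (g x) := rfl

@[ext]
theorem ext {σ τ : StarMaps k V M N}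
    (h : ∀ (i j : V) (a : i ⟶ j) (x : M), σ.1 i j a x = τ.1 i j a x) : σ = τ := by
  apply Subtype.ext
  funext i j a
  exact LinearMap.ext (h i j a)

/-- The linear map `g ↦ τ g - g σ`, whose kernel consists of the homomorphisms of
`D`-modules. -/
def delta (σ : StarMaps k V M M) (τ : StarMaps k V N N) :
    (M →ₗ[PathAlgebra k V] N) →ₗ[k] StarMaps k V M N where
  toFun g := precomp τ g - postcomp g σ
  map_add' g h := by
    ext i j a x
    simp [precomp, postcomp]
    abel
  map_smul' c g := by
    ext i j a x
    simp [precomp, postcomp, smul_sub]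

theorem delta_apply (σ : StarMaps k V M M) (τ : StarMaps k V N N)
    (g : M →ₗ[PathAlgebra k V] N) {i j : V} (a : i ⟶ j) (x : M) :
    (delta σ τ g).1 i j a x = τ.1 i j a (g x) - g (σ.1 i j a x) := rfl

section Lift

variable (σ : StarMaps k V M M)

/-- The action of the arrows of the double quiver on `M` given by a family of star maps. -/
def action : ∀ i j : Quiver.Symmetrify V, (i ⟶ j) → Module.End k M
  | _, _, Sum.inl a => Algebra.lsmul k k M (arrow (V := V) k a)
  | _, _, Sum.inr a => σ.1 _ _ a

/-- The representation of the double quiver given by a family of star maps. -/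
def liftPath : PathAlgebra k (Quiver.Symmetrify V) →ₐ[k] Module.End k M :=
  PathAlgebra.lift (V := Quiver.Symmetrify V)
    (ε := fun i => Algebra.lsmul k k M (vertex (V := V) k i)) (ρ := action σ)
    (fun i => (map_mul _ _ _).symm.trans (congrArg _ (vertex_mul_self (V := V) i)))
    (fun i j h => (map_mul _ _ _).symm.trans
      ((congrArg _ (vertex_mul_vertex_of_ne (V := V) h)).trans (map_zero _)))
    (fun i j a => by
      rcases a with a | a
      · exact (map_mul _ _ _).symm.trans (congrArg _ (vertex_mul_arrow (V := V) a))
      · exact LinearMap.ext fun x => vertex_smul σ a x)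
    ((map_sum _ _ _).symm.trans ((congrArg _ (sum_vertex (V := V))).trans (map_one _)))

theorem liftPath_arrow {i j : Quiver.Symmetrify V} (a : i ⟶ j) :
    liftPath σ (arrow k a) = action σ i j a := by
  refine PathAlgebra.lift_arrow (V := Quiver.Symmetrify V) _ _ _ (fun i j a => ?_) _ a
  rcases a with a | a
  · exact (map_mul _ _ _).symm.trans (congrArg _ (arrow_mul_vertex (V := V) a))
  · exact LinearMap.ext fun x => apply_vertex_smul σ a x

theorem liftPath_vertex (i : V) :
    liftPath σ (vertex (V := Quiver.Symmetrify V) k i) = Algebra.lsmul k k M (vertex k i) :=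
  PathAlgebra.lift_vertex (V := Quiver.Symmetrify V) _ _ _ _ i

theorem liftPath_dblArrow {i j : V} (a : i ⟶ j) :
    liftPath σ (dblArrow k a) = Algebra.lsmul k k M (arrow k a) :=
  liftPath_arrow σ (i := i) (j := j) (Sum.inl a)

theorem liftPath_dblStar {i j : V} (a : i ⟶ j) : liftPath σ (dblStar k a) = σ.1 i j a :=
  liftPath_arrow σ (i := j) (j := i) (Sum.inr a)

/-- The `D`-module structure on a `kV`-module given by a family of star maps. -/
def lift : DoubleAlgebra k V →ₐ[k] Module.End k M :=
  RingQuot.liftAlgHom k ⟨liftPath σ, by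
    rintro _ _ (⟨a⟩ | ⟨a, b, hab⟩)
    · simp only [map_mul, map_sum, liftPath_dblArrow, liftPath_dblStar]
      ext x
      simp [apply_arrow_smul]
    · simp only [map_mul, map_zero, liftPath_dblArrow, liftPath_dblStar]
      ext x
      simp [apply_arrow_smul_of_ne _ _ _ hab]⟩

theorem lift_toDouble (x : PathAlgebra k (Quiver.Symmetrify V)) :
    lift σ (toDouble k x) = liftPath σ x :=
  RingQuot.liftAlgHom_mkAlgHom_apply ..

theorem lift_star {i j : V} (a : i ⟶ j) : lift σ (star a) = σ.1 i j a :=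
  (lift_toDouble σ _).trans (liftPath_dblStar σ a)

theorem lift_ofPathAlgebra (a : PathAlgebra k V) (x : M) :
    lift σ (ofPathAlgebra k V a) x = a • x := by
  suffices h : a ∈ AlgHom.equalizer ((lift σ).comp (ofPathAlgebra k V)) (Algebra.lsmul k k M) from
    LinearMap.congr_fun h x
  apply mem_of_generators
  · intro i
    rw [AlgHom.mem_equalizer, AlgHom.comp_apply, ofPathAlgebra_vertex, lift_toDouble,
      liftPath_vertex]
  · intro i j a
    rw [AlgHom.mem_equalizer, AlgHom.comp_apply, ofPathAlgebra_arrow, lift_toDouble,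
      liftPath_dblArrow]

end Lift

end StarMaps

end StarMaps

/-! ### `Rep(D, P(d))` as a vector space, and `End_D X` as a kernel -/

section RepStar

open PathAlgebra

variable {k : Type u} [Field k] {V : Type v} [Quiver.{w} V] [Fintype V]
  [∀ i j : V, Fintype (i ⟶ j)] {d : V → ℕ}

namespace Rep

/-- The actions of the elements `a^*` in a point of `Rep(D, P(d))`. -/
def stars (X : Rep k V d) : StarMaps k V (ProjModule k V d) (ProjModule k V d) :=
  ⟨fun _ _ a => X.toAlgHom (star a), by
    refine ⟨fun i j a x => ?_, fun i j a x => ?_, fun i j a x => ?_, fun i h j a b hab x => ?_⟩ <;>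
      simp only [← X.restrict, ← Module.End.mul_apply, ← map_mul]
    · rw [vertex_mul_star]
    · rw [star_mul_vertex]
    · rw [star_mul_arrow_self]
      simp only [map_sum, LinearMap.sum_apply]
    · rw [star_mul_arrow_of_ne _ _ hab, map_zero, LinearMap.zero_apply]⟩

/-- The action of `kΔ` is prescribed, and `kΔ` together with the `a^*` generates `D`. -/
theorem stars_injective : Function.Injective (stars (k := k) (V := V) (d := d)) := by
  intro X Y h
  apply Rep.ext
  apply AlgHom.ext
  intro a
  refine mem_of_ofPathAlgebra_of_star (AlgHom.equalizer X.toAlgHom Y.toAlgHom) ?_ ?_ a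
  · intro a
    rw [AlgHom.mem_equalizer]
    ext1 x
    rw [X.restrict, Y.restrict]
  · intro i j a
    exact congrFun (congrFun (congrFun (congrArg Subtype.val h) i) j) a

/-- The point of `Rep(D, P(d))` given by a family of star maps. -/
def ofStars (σ : StarMaps k V (ProjModule k V d) (ProjModule k V d)) : Rep k V d where
  toAlgHom := StarMaps.lift σ
  restrict := StarMaps.lift_ofPathAlgebra σ

/-- With `stars_injective`, this makes `stars` a bijection from `Rep(D, P(d))` onto a vector space.
-/
theorem stars_ofStars (σ : StarMaps k V (ProjModule k V d) (ProjModule k V d)) :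
    (ofStars σ).stars = σ := by
  apply StarMaps.ext
  intro i j a x
  exact LinearMap.congr_fun (StarMaps.lift_star σ a) x

/-- `End_D X` is the kernel of the commutator with the family of star maps. -/
def endEquiv (X : Rep k V d) : X.EndD ≃ₗ[k] LinearMap.ker (StarMaps.delta X.stars X.stars) where
  toFun f := ⟨{ toFun := f
                map_add' := f.map_add
                map_smul' := fun a x => by
                  have := f.map_smul (ofPathAlgebra k V a) x
                  refine Eq.trans (congrArg f ?_) (this.trans ?_)
                  · exact (X.restrict a x).symm
                  · exact X.restrict a (f x) }, by
    rw [LinearMap.mem_ker]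
    apply StarMaps.ext
    intro i j a x
    exact sub_eq_zero.2 (f.map_smul (star a) x).symm⟩
  map_add' f g := rfl
  map_smul' c f := rfl
  invFun g :=
    { toFun := g.1
      map_add' := g.1.map_add
      map_smul' := fun a => by
        refine fun x => LinearMap.congr_fun (f := (g.1.restrictScalars k) ∘ₗ X.toAlgHom a)
          (g := X.toAlgHom a ∘ₗ (g.1.restrictScalars k)) ?_ x
        -- The elements of `D` whose action commutes with `g` form a subalgebra, so it is enough to
        -- test generators.
        refine (mem_of_ofPathAlgebra_of_star
          ((Subalgebra.centralizer k {g.1.restrictScalars k}).comap X.toAlgHom) ?_ ?_ a) _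
            (Set.mem_singleton _)
        · rintro a _ rfl
          ext1 x
          simp only [Module.End.mul_apply]
          refine ((congrArg _ (X.restrict a x)).trans ?_).trans (X.restrict a _).symm
          exact g.1.map_smul a x
        · rintro i j a _ rfl
          ext1 x
          have := congrArg (fun τ => τ.1 i j a x) (LinearMap.mem_ker.1 g.2)
          exact (sub_eq_zero.1 this).symm }
  left_inv f := rfl
  right_inv g := rfl

theorem stars_smul (g : AutGroup k V d) (X : Rep k V d) {i j : V} (a : i ⟶ j)
    (x : ProjModule k V d) : (g • X).stars.1 i j a x = g (X.stars.1 i j a (g.symm x)) := rfl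

end Rep

end RepStar

/-! ### Splitting off the last arrow of a path -/

section Cofactor

variable {k : Type u} [Field k] {V : Type v} [Quiver.{w} V]

namespace PathAlgebra

/-- The coefficient of a trivial path. -/
def nilCoeff (i : V) : PathAlgebra k V →ₗ[k] k := (basis k V).coord ⟨i, i, Quiver.Path.nil⟩

theorem nilCoeff_ofPath {i j : V} (l : V) (p : Quiver.Path i j) [Decidable (
    (⟨i, j, p⟩ : AllPaths V) = ⟨l, l, Quiver.Path.nil⟩)] :
    nilCoeff l (ofPath k p) =
      if (⟨i, j, p⟩ : AllPaths V) = ⟨l, l, Quiver.Path.nil⟩ then 1 else 0 := by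
  rw [nilCoeff, ofPath, Module.Basis.coord_apply, Module.Basis.repr_self, Finsupp.single_apply]

theorem nilCoeff_cons {i j h : V} (l : V) (p : Quiver.Path i j) (a : j ⟶ h) :
    nilCoeff l (ofPath k (p.cons a)) = 0 := by
  classical
  rw [nilCoeff_ofPath, if_neg]
  intro e
  obtain rfl : i = l := congrArg (fun q : AllPaths V => q.1) e
  obtain rfl : h = i := congrArg (fun q : AllPaths V => q.2.1) e
  simp at e

theorem nilCoeff_vertex_self (i : V) : nilCoeff i (vertex k i) = 1 := by
  classical
  rw [vertex, nilCoeff_ofPath, if_pos rfl]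

theorem nilCoeff_vertex_of_ne {i l : V} (h : i ≠ l) : nilCoeff l (vertex k i) = 0 := by
  classical
  rw [vertex, nilCoeff_ofPath, if_neg]
  exact fun e => h (congrArg (fun q : AllPaths V => q.1) e)

theorem nilCoeff_vertex_mul_self (l i : V) :
    nilCoeff l (vertex k i) * nilCoeff l (vertex k i) = nilCoeff l (vertex k i) := by
  by_cases h : i = l
  · subst h; rw [nilCoeff_vertex_self, mul_one]
  · rw [nilCoeff_vertex_of_ne h, mul_zero]

/-- A product of two paths is trivial only if both factors are, so the coefficient of `e_l` is
multiplicative. It describes the action of `kΔ` on tops. -/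
theorem nilCoeff_mul (l : V) (x y : PathAlgebra k V) :
    nilCoeff l (x * y) = nilCoeff l x * nilCoeff l y := by
  induction x using PathAlgebra.induction with
  | h0 => simp [PathAlgebra.zero_mul']
  | hadd a a' ha ha' => simp only [PathAlgebra.add_mul', map_add, ha, ha', add_mul]
  | @hs r i j p =>
    induction y using PathAlgebra.induction with
    | h0 => simp [PathAlgebra.mul_zero']
    | hadd b b' hb hb' => simp only [PathAlgebra.mul_add', map_add, hb, hb', mul_add]
    | @hs s i' j' q =>
      simp only [PathAlgebra.smul_mul', PathAlgebra.mul_smul', map_smul, smul_eq_mul]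
      suffices h : nilCoeff l (ofPath k p * ofPath k q) =
          nilCoeff l (ofPath k p) * nilCoeff l (ofPath k q) by rw [h]; ring
      by_cases h : j' = i
      · subst h
        rw [ofPath_mul_ofPath]
        cases p with
        | cons p a => rw [Quiver.Path.comp_cons, nilCoeff_cons, nilCoeff_cons, zero_mul]
        | nil =>
          rw [Quiver.Path.comp_nil]
          cases q with
          | cons q a => rw [nilCoeff_cons, mul_zero]
          | nil =>
            exact (nilCoeff_vertex_mul_self l _).symm
      · rw [ofPath_mul_ofPath_of_ne k _ _ h, map_zero]
        cases p with
        | cons p a => rw [nilCoeff_cons, zero_mul]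
        | nil =>
          cases q with
          | cons q a => rw [nilCoeff_cons, mul_zero]
          | nil =>
            change 0 = nilCoeff l (vertex k i) * nilCoeff l (vertex k i')
            by_cases hl : i = l
            · subst hl; rw [nilCoeff_vertex_of_ne h, mul_zero]
            · rw [nilCoeff_vertex_of_ne hl, zero_mul]

open Classical in
/-- The cofactor of an arrow in a path which ends with this arrow. -/
def cofactorPath {i j : V} (a : i ⟶ j) : AllPaths V → PathAlgebra k V
  | ⟨_, _, .nil⟩ => 0
  | ⟨_, m, .cons (b := h) q b⟩ =>
    if (⟨h, m, b⟩ : Σ i j : V, (i ⟶ j)) = ⟨i, j, a⟩ then ofPath k q else 0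

/-- The cofactor of an arrow: the linear map which sends a path `a q` to `q`, and a path which does
not end with the arrow `a` to zero. -/
def cofactor {i j : V} (a : i ⟶ j) : PathAlgebra k V →ₗ[k] PathAlgebra k V :=
  (basis k V).constr k (cofactorPath a)

variable {i j : V} (a : i ⟶ j)

theorem cofactor_nil (l : V) : cofactor a (vertex k l) = 0 := by
  rw [cofactor, vertex, ofPath, Module.Basis.constr_basis]; rfl

theorem cofactor_cons_self {h : V} (q : Quiver.Path h i) :
    cofactor a (ofPath k (q.cons a)) = ofPath k q := by
  rw [cofactor, ofPath, Module.Basis.constr_basis]; exact if_pos rfl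

theorem cofactor_cons_of_ne {h l m : V} (q : Quiver.Path h l) (b : l ⟶ m)
    (hab : (⟨l, m, b⟩ : Σ i j : V, (i ⟶ j)) ≠ ⟨i, j, a⟩) :
    cofactor a (ofPath k (q.cons b)) = 0 := by
  rw [cofactor, ofPath, Module.Basis.constr_basis]; exact if_neg hab

theorem cofactor_arrow_mul_self (x : PathAlgebra k V) :
    cofactor a (arrow k a * x) = vertex k i * x := by
  induction x using PathAlgebra.induction with
  | h0 => simp only [PathAlgebra.mul_zero', map_zero]
  | hadd a a' ha ha' => simp only [PathAlgebra.mul_add', map_add, ha, ha']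
  | @hs r l m p =>
    simp only [PathAlgebra.mul_smul', map_smul]
    by_cases h : m = i
    · subst h
      rw [arrow_mul_ofPath, cofactor_cons_self, vertex_mul_ofPath]
    · rw [arrow, vertex, ofPath_mul_ofPath_of_ne k _ _ h, ofPath_mul_ofPath_of_ne k _ _ h, map_zero]

theorem cofactor_arrow_mul_of_ne {l m : V} (b : l ⟶ m)
    (hab : (⟨l, m, b⟩ : Σ i j : V, (i ⟶ j)) ≠ ⟨i, j, a⟩) (x : PathAlgebra k V) :
    cofactor a (arrow k b * x) = 0 := by
  induction x using PathAlgebra.induction with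
  | h0 => simp only [PathAlgebra.mul_zero', map_zero]
  | hadd a a' ha ha' => simp only [PathAlgebra.mul_add', map_add, ha, ha', add_zero]
  | @hs r l' m' p =>
    simp only [PathAlgebra.mul_smul', map_smul]
    by_cases h : m' = l
    · subst h
      rw [arrow_mul_ofPath, cofactor_cons_of_ne _ _ _ hab, smul_zero]
    · rw [arrow, ofPath_mul_ofPath_of_ne k _ _ h, map_zero, smul_zero]

/-- Two linear maps agree if they agree on trivial paths and on products of an arrow and a path. -/
theorem linearMap_ext {M : Type*} [AddCommGroup M] [Module k M] {f g : PathAlgebra k V →ₗ[k] M}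
    (hn : ∀ l : V, f (vertex k l) = g (vertex k l))
    (hc : ∀ (h l m : V) (q : Quiver.Path h l) (b : l ⟶ m),
      f (ofPath k (q.cons b)) = g (ofPath k (q.cons b))) (x : PathAlgebra k V) : f x = g x := by
  induction x using PathAlgebra.induction with
  | h0 => rw [map_zero, map_zero]
  | hadd a a' ha ha' => rw [map_add, map_add, ha, ha']
  | @hs r l m p =>
    rw [map_smul, map_smul]
    cases p with
    | nil => rw [← vertex, hn]
    | cons q b => rw [hc]

theorem vertex_mul_cofactor [Fintype V] (x : PathAlgebra k V) :
    vertex k i * cofactor a x = cofactor a x := by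
  refine linearMap_ext (f := LinearMap.mulLeft k (vertex k i) ∘ₗ cofactor a) (g := cofactor a)
    (fun l => ?_) (fun h l m q b => ?_) x
  · simp [cofactor_nil]
  · by_cases hab : (⟨l, m, b⟩ : Σ i j : V, (i ⟶ j)) = ⟨i, j, a⟩
    · cases hab
      simp [cofactor_cons_self, vertex_mul_ofPath]
    · simp [cofactor_cons_of_ne _ _ _ hab]

theorem cofactor_vertex_mul [Fintype V] (x : PathAlgebra k V) :
    cofactor a (vertex k j * x) = cofactor a x := by
  refine linearMap_ext (f := cofactor a ∘ₗ LinearMap.mulLeft k (vertex k j)) (g := cofactor a)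
    (fun l => ?_) (fun h l m q b => ?_) x
  · by_cases h : j = l
    · subst h
      simp [vertex_mul_self]
    · simp [vertex_mul_vertex_of_ne h, cofactor_nil]
  · by_cases hab : (⟨l, m, b⟩ : Σ i j : V, (i ⟶ j)) = ⟨i, j, a⟩
    · cases hab
      simp [vertex_mul_ofPath]
    · rw [cofactor_cons_of_ne _ _ _ hab, LinearMap.comp_apply, LinearMap.mulLeft_apply,
        ← arrow_mul_ofPath, ← mul_assoc]
      by_cases h : j = m
      · subst h
        rw [vertex_mul_arrow, cofactor_arrow_mul_of_ne _ _ hab]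
      · rw [vertex_mul_arrow_of_ne _ h, zero_mul, map_zero]

/-- The cofactor is not right linear: for `a : i ⟶ j` it kills `e_j` but sends `e_j a` to `e_i`.
Compatibility with trivial paths is enough for it to preserve each left ideal `kΔ e_s`, hence to act
on `P(d)`. -/
theorem cofactor_mul_vertex [Fintype V] (x : PathAlgebra k V) (s : V) :
    cofactor a (x * vertex k s) = cofactor a x * vertex k s := by
  refine linearMap_ext (f := cofactor a ∘ₗ LinearMap.mulRight k (vertex k s))
    (g := LinearMap.mulRight k (vertex k s) ∘ₗ cofactor a)
    (fun l => ?_) (fun h l m q b => ?_) x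
  · by_cases h : l = s
    · subst h
      simp [vertex_mul_self, cofactor_nil]
    · simp [vertex_mul_vertex_of_ne h, cofactor_nil]
  · simp only [LinearMap.comp_apply, LinearMap.mulRight_apply, ← arrow_mul_ofPath, mul_assoc]
    by_cases hab : (⟨l, m, b⟩ : Σ i j : V, (i ⟶ j)) = ⟨i, j, a⟩
    · cases hab
      rw [cofactor_arrow_mul_self, cofactor_arrow_mul_self, ← mul_assoc, vertex_mul_ofPath]
    · rw [cofactor_arrow_mul_of_ne _ _ hab, cofactor_arrow_mul_of_ne _ _ hab, zero_mul]

/-- The decomposition of an element of the path algebra into its part of degree zero and its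
part in the arrow ideal. -/
theorem eq_sum_cofactor [Fintype V] [∀ i j : V, Fintype (i ⟶ j)] (x : PathAlgebra k V) :
    ∑ l : V, nilCoeff l x • vertex k l +
      ∑ j : V, ∑ i : V, ∑ a : i ⟶ j, arrow k a * cofactor a x = x := by
  refine Eq.trans ?_ (linearMap_ext (f := ∑ l : V, (nilCoeff l).smulRight (vertex k l) +
    ∑ j : V, ∑ i : V, ∑ a : i ⟶ j, LinearMap.mulLeft k (arrow k a) ∘ₗ cofactor a)
    (g := LinearMap.id) (fun l => ?_) (fun h l m q b => ?_) x)
  · simp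
  · simp only [LinearMap.add_apply, LinearMap.sum_apply, LinearMap.smulRight_apply,
      LinearMap.comp_apply, cofactor_nil, map_zero, Finset.sum_const_zero, add_zero]
    rw [Finset.sum_eq_single l (fun m _ h => by rw [nilCoeff_vertex_of_ne h.symm, zero_smul])
      (by simp), nilCoeff_vertex_self, one_smul, LinearMap.id_apply]
  · simp only [LinearMap.add_apply, LinearMap.sum_apply, LinearMap.smulRight_apply,
      LinearMap.comp_apply, nilCoeff_cons, zero_smul, Finset.sum_const_zero, zero_add,
      LinearMap.mulLeft_apply]
    rw [Finset.sum_eq_single m, Finset.sum_eq_single l, Finset.sum_eq_single b, cofactor_cons_self,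
      arrow_mul_ofPath, LinearMap.id_apply]
    · intro a _ hab
      rw [cofactor_cons_of_ne, mul_zero]
      rintro ⟨⟩
      exact hab rfl
    · simp
    · intro i _ hi
      refine Finset.sum_eq_zero fun a _ => ?_
      rw [cofactor_cons_of_ne, mul_zero]
      rintro ⟨⟩
      exact hi rfl
    · simp
    · intro i _ hi
      refine Finset.sum_eq_zero fun j _ => Finset.sum_eq_zero fun a _ => ?_
      rw [cofactor_cons_of_ne, mul_zero]
      rintro ⟨⟩
      exact hi rfl
    · simp

end PathAlgebra

/-- A finite quiver without oriented cycles has finitely many paths. -/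
theorem finite_path [Finite V] [∀ i j : V, Finite (i ⟶ j)]
    (acyclic : ∀ (i : V) (p : Quiver.Path i i), p = Quiver.Path.nil) (i j : V) :
    Finite (Quiver.Path i j) := by
  -- Being joined by a path of positive length is transitive, and irreflexive by acyclicity, hence
  -- well-founded on a finite set. The induction is on the end point, by removing the last arrow.
  let r (l m : V) : Prop := ∃ p : Quiver.Path l m, p.length ≠ 0
  have : IsTrans V r := ⟨fun a b c ⟨p, hp⟩ ⟨q, _⟩ => ⟨p.comp q, by simp; omega⟩⟩
  have : Std.Irrefl r := ⟨fun a ⟨p, hp⟩ => hp (by rw [acyclic a p]; rfl)⟩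
  have wf : WellFounded r := Finite.wellFounded_of_trans_of_irrefl r
  induction j using wf.induction with
  | _ j ih =>
    have (l : V) (a : l ⟶ j) : Finite (Quiver.Path i l) := ih l ⟨a.toPath, by simp⟩
    have (l : V) : Finite (Σ _ : l ⟶ j, Quiver.Path i l) := @Finite.instSigma _ _ _ (this l)
    let f : Quiver.Path i j → Option (Σ (l : V) (_ : l ⟶ j), Quiver.Path i l)
      | .nil => none
      | .cons p a => some ⟨_, a, p⟩
    refine Finite.of_injective f ?_
    intro p q h
    cases p with
    | nil =>
      cases q with
      | nil => rfl
      | cons q b => simp [f] at h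
    | cons p a =>
      cases q with
      | nil => simp [f] at h
      | cons q b =>
        simp only [f, Option.some.injEq] at h
        cases h
        rfl

theorem finite_pathAlgebra [Finite V] [∀ i j : V, Finite (i ⟶ j)]
    (acyclic : ∀ (i : V) (p : Quiver.Path i i), p = Quiver.Path.nil) :
    Module.Finite k (PathAlgebra k V) := by
  have := finite_path acyclic
  exact Module.Finite.of_basis (PathAlgebra.basis k V)

theorem finite_projModule [Fintype V] [∀ i j : V, Finite (i ⟶ j)]
    (acyclic : ∀ (i : V) (p : Quiver.Path i i), p = Quiver.Path.nil) (d : V → ℕ) :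
    Module.Finite k (ProjModule k V d) := by
  have := finite_pathAlgebra (k := k) acyclic
  have (i : V) : Module.Finite k (Submodule.span (PathAlgebra k V) {PathAlgebra.vertex k i}) :=
    Module.Finite.of_injective ((Submodule.subtype _).restrictScalars k) Subtype.val_injective
  infer_instance

end Cofactor

/-! ### Star families as endomorphisms vanishing on the top, and the dimension count -/

section Dimension

open PathAlgebra

variable {k : Type u} [Field k] {V : Type v} [Quiver.{w} V] [Fintype V]
  [∀ i j : V, Fintype (i ⟶ j)]

namespace StarMaps

variable {M N : Type*}
  [AddCommGroup M] [Module k M] [Module (PathAlgebra k V) M] [IsScalarTower k (PathAlgebra k V) M]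
  [AddCommGroup N] [Module k N] [Module (PathAlgebra k V) N] [IsScalarTower k (PathAlgebra k V) N]

/-- The sum of `b σ_b` over all arrows `b` ending at a given vertex. -/
def into (σ : StarMaps k V M N) (i : V) (x : M) : N :=
  ∑ h : V, ∑ b : h ⟶ i, arrow k b • σ.1 h i b x

variable (σ : StarMaps k V M N)

theorem vertex_smul_into_self (i : V) (x : M) : vertex k i • into σ i x = into σ i x := by
  simp only [into, Finset.smul_sum, ← mul_smul, vertex_mul_arrow]

theorem vertex_smul_into_of_ne {i l : V} (h : l ≠ i) (x : M) : vertex k l • into σ i x = 0 := by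
  simp only [into, Finset.smul_sum, ← mul_smul, vertex_mul_arrow_of_ne _ h, zero_smul,
    Finset.sum_const_zero]

theorem arrow_smul_into_of_ne {i h j : V} (b : h ⟶ j) (hi : h ≠ i) (x : M) :
    arrow k b • into σ i x = 0 := by
  rw [← arrow_mul_vertex, mul_smul, vertex_smul_into_of_ne σ hi, smul_zero]

theorem into_vertex_smul_self (i : V) (x : M) : into σ i (vertex k i • x) = into σ i x := by
  simp only [into, apply_vertex_smul]

theorem into_vertex_smul_of_ne {i l : V} (h : i ≠ l) (x : M) :
    into σ i (vertex k l • x) = 0 := by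
  rw [← into_vertex_smul_self, ← mul_smul, vertex_mul_vertex_of_ne h, zero_smul]
  simp [into]

/-- The relations `a^* b = 0` kill all summands except that of `b`, and the relation for `b^* b`
rewrites the remaining one. -/
theorem into_arrow_smul_self {h l : V} (b : h ⟶ l) (x : M) :
    into σ l (arrow k b • x) = arrow k b • into σ h x := by
  rw [into, Finset.sum_eq_single h, Finset.sum_eq_single b, apply_arrow_smul]
  · rfl
  · intro a _ hab
    rw [apply_arrow_smul_of_ne, smul_zero]
    rintro ⟨⟩
    exact hab rfl
  · simp
  · intro i _ hi
    refine Finset.sum_eq_zero fun a _ => ?_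
    rw [apply_arrow_smul_of_ne, smul_zero]
    rintro ⟨⟩
    exact hi rfl
  · simp

theorem into_arrow_smul_of_ne {h l i : V} (b : h ⟶ l) (hi : i ≠ l) (x : M) :
    into σ i (arrow k b • x) = 0 := by
  rw [← vertex_mul_arrow, mul_smul, into_vertex_smul_of_ne σ hi]

/-- The linear map `σ ↦ ∑_a a σ_a` from families of star maps to `kV`-linear maps. -/
def total : StarMaps k V M N →ₗ[k] (M →ₗ[PathAlgebra k V] N) where
  toFun σ :=
    { toFun := fun x => ∑ i, into σ i x
      map_add' := fun x y => by simp [into, Finset.sum_add_distrib]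
      map_smul' := by
        let f : M →ₗ[k] N := ∑ i : V, ∑ h : V, ∑ b : h ⟶ i,
          Algebra.lsmul k k N (arrow k b) ∘ₗ σ.1 h i b
        have hf (x : M) : f x = ∑ i, into σ i x := by simp [f, into]
        -- The scalars that commute with `f` form a subalgebra, so only trivial paths and arrows
        -- have to be checked.
        let S : Subalgebra k (PathAlgebra k V) :=
          { carrier := {a | ∀ x, f (a • x) = a • f x}
            mul_mem' := fun {a b} ha hb x => by rw [mul_smul, ha, hb, mul_smul]
            add_mem' := fun {a b} ha hb x => by rw [add_smul, map_add, ha, hb, add_smul]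
            algebraMap_mem' := fun c x => by
              rw [algebraMap_smul, algebraMap_smul, map_smul] }
        intro a x
        rw [← hf, ← hf]
        refine mem_of_generators S (fun l x => ?_) (fun h l b x => ?_) a x
        · rw [hf, hf, Finset.smul_sum]
          refine Finset.sum_congr rfl fun i _ => ?_
          by_cases h : l = i
          · subst h
            rw [into_vertex_smul_self, vertex_smul_into_self]
          · rw [into_vertex_smul_of_ne σ (Ne.symm h), vertex_smul_into_of_ne σ h]
        -- For `b : h ⟶ l`, only the index `l` contributes to the sum at `b x`, and only the index
        -- `h` survives multiplication by `b`.
        · rw [hf, hf, Finset.smul_sum, Finset.sum_eq_single l, Finset.sum_eq_single h,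
            into_arrow_smul_self]
          · exact fun i _ hi => arrow_smul_into_of_ne σ b hi.symm x
          · simp
          · exact fun i _ hi => into_arrow_smul_of_ne σ b hi x
          · simp }
  map_add' σ τ := by
    ext x
    simp [into, Finset.sum_add_distrib]
  map_smul' c σ := by
    ext x
    simp [into, Finset.smul_sum, smul_comm c]

theorem total_apply (x : M) : total σ x = ∑ i, into σ i x := rfl

end StarMaps

namespace ProjModule

variable {d : V → ℕ}

theorem mul_vertex (x : ProjModule k V d) (i : V) (s : Fin (d i)) :
    (x i s : PathAlgebra k V) * vertex k i = x i s := by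
  obtain ⟨a, ha⟩ := Submodule.mem_span_singleton.1 (x i s).2
  rw [← ha, smul_eq_mul, mul_assoc, vertex_mul_self]

theorem coe_smul (a : PathAlgebra k V) (x : ProjModule k V d) (i : V) (s : Fin (d i)) :
    ((a • x) i s : PathAlgebra k V) = a * x i s := rfl

open Classical in
variable (k d) in
/-- The generators of `P(d)`. -/
def gen (i : V) (s : Fin (d i)) : ProjModule k V d :=
  Pi.single i (Pi.single s ⟨vertex k i, Submodule.mem_span_singleton_self _⟩)

theorem gen_self (i : V) (s : Fin (d i)) : (gen k d i s i s : PathAlgebra k V) = vertex k i := by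
  simp [gen]

theorem gen_of_ne (i : V) {s t : Fin (d i)} (h : t ≠ s) : gen k d i s i t = 0 := by
  simp [gen, h]

theorem gen_of_ne' {i j : V} (s : Fin (d i)) (h : j ≠ i) : gen k d i s j = 0 := by
  simp [gen, h]

theorem sum_smul_gen (x : ProjModule k V d) :
    ∑ i, ∑ s, (x i s : PathAlgebra k V) • gen k d i s = x := by
  funext j t
  rw [Finset.sum_apply, Finset.sum_apply, Finset.sum_eq_single j, Finset.sum_apply,
    Finset.sum_apply, Finset.sum_eq_single t]
  · apply Subtype.ext
    rw [coe_smul, gen_self, mul_vertex]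
  · intro s _ hs
    rw [Pi.smul_apply, Pi.smul_apply, gen_of_ne _ hs.symm, smul_zero]
  · simp
  · intro i _ hi
    rw [Finset.sum_apply, Finset.sum_apply]
    refine Finset.sum_eq_zero fun s _ => ?_
    rw [Pi.smul_apply, Pi.smul_apply, gen_of_ne' _ hi.symm, Pi.zero_apply, smul_zero]
  · simp

variable (k d) in
/-- The coefficient of a generator in an element of `P(d)`. -/
def coeff (i : V) (s : Fin (d i)) : ProjModule k V d →ₗ[k] k where
  toFun x := nilCoeff i (x i s : PathAlgebra k V)
  map_add' _ _ := map_add (nilCoeff i) _ _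
  map_smul' _ _ := map_smul (nilCoeff i) _ _

theorem coeff_apply (i : V) (s : Fin (d i)) (x : ProjModule k V d) :
    coeff k d i s x = nilCoeff i (x i s : PathAlgebra k V) := rfl

theorem coeff_smul (i : V) (s : Fin (d i)) (a : PathAlgebra k V) (x : ProjModule k V d) :
    coeff k d i s (a • x) = nilCoeff i a * coeff k d i s x := nilCoeff_mul i _ _

theorem nilCoeff_of_ne (x : ProjModule k V d) {i l : V} (h : i ≠ l) (s : Fin (d i)) :
    nilCoeff l (x i s : PathAlgebra k V) = 0 := by
  rw [← mul_vertex, nilCoeff_mul, nilCoeff_vertex_of_ne h, mul_zero]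

/-- The cofactor of an arrow in the elements of `P(d)`. -/
def cofactor {i j : V} (a : i ⟶ j) : ProjModule k V d →ₗ[k] ProjModule k V d where
  toFun x := fun l s => ⟨PathAlgebra.cofactor a (x l s), Submodule.mem_span_singleton.2
    ⟨PathAlgebra.cofactor a (x l s), by
      rw [smul_eq_mul, ← cofactor_mul_vertex, mul_vertex]⟩⟩
  map_add' x y := by
    funext l s
    exact Subtype.ext (map_add (PathAlgebra.cofactor a) _ _)
  map_smul' c x := by
    funext l s
    exact Subtype.ext (map_smul (PathAlgebra.cofactor a) _ _)

theorem coe_cofactor {i j : V} (a : i ⟶ j) (x : ProjModule k V d) (l : V) (s : Fin (d l)) :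
    (cofactor a x l s : PathAlgebra k V) = PathAlgebra.cofactor a (x l s) := rfl

theorem ext_coe {x y : ProjModule k V d}
    (h : ∀ l s, (x l s : PathAlgebra k V) = y l s) : x = y :=
  funext fun l => funext fun s => Subtype.ext (h l s)

variable {i j : V} (a : i ⟶ j) (x : ProjModule k V d)

theorem vertex_smul_cofactor : vertex k i • cofactor a x = cofactor a x :=
  ext_coe fun _ _ => vertex_mul_cofactor a _

theorem cofactor_vertex_smul : cofactor a (vertex k j • x) = cofactor a x :=
  ext_coe fun _ _ => cofactor_vertex_mul a _

theorem cofactor_arrow_smul_self : cofactor a (arrow k a • x) = vertex k i • x :=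
  ext_coe fun _ _ => cofactor_arrow_mul_self a _

theorem cofactor_arrow_smul_of_ne {l m : V} (b : l ⟶ m)
    (hab : (⟨l, m, b⟩ : Σ i j : V, (i ⟶ j)) ≠ ⟨i, j, a⟩) : cofactor a (arrow k b • x) = 0 :=
  ext_coe fun _ _ => cofactor_arrow_mul_of_ne a b hab _

theorem eq_sum_cofactor (hx : ∀ i s, coeff k d i s x = 0) :
    ∑ j : V, ∑ i : V, ∑ a : i ⟶ j, arrow k a • cofactor a x = x := by
  refine ext_coe fun l s => ?_
  have h : ∑ m : V, nilCoeff m (x l s : PathAlgebra k V) • vertex k m = 0 := by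
    refine Finset.sum_eq_zero fun m _ => ?_
    by_cases hm : l = m
    · subst hm
      rw [← coeff_apply, hx, zero_smul]
    · rw [nilCoeff_of_ne x hm, zero_smul]
  conv_rhs => rw [← PathAlgebra.eq_sum_cofactor (x l s : PathAlgebra k V), h, zero_add]
  simp only [Finset.sum_apply, Submodule.coe_sum, coe_smul, coe_cofactor]

open StarMaps

theorem cofactor_into_self (σ : StarMaps k V (ProjModule k V d) (ProjModule k V d)) :
    cofactor a (into σ j x) = σ.1 i j a x := by
  rw [into, map_sum, Finset.sum_eq_single i, map_sum, Finset.sum_eq_single a,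
    cofactor_arrow_smul_self, StarMaps.vertex_smul]
  · intro b _ hab
    rw [cofactor_arrow_smul_of_ne]
    rintro ⟨⟩
    exact hab rfl
  · simp
  · intro h _ hi
    rw [map_sum]
    refine Finset.sum_eq_zero fun b _ => ?_
    rw [cofactor_arrow_smul_of_ne]
    rintro ⟨⟩
    exact hi rfl
  · simp

/-- The part of `∑ b σ_b(x)` that ends with `a` is `a σ_a(x)`, and removing `a` loses nothing
because `σ_a(x)` lies in `e_i P(d)`. So `total` is injective. -/
theorem cofactor_total (σ : StarMaps k V (ProjModule k V d) (ProjModule k V d)) :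
    cofactor a (total σ x) = σ.1 i j a x := by
  rw [total_apply, map_sum, Finset.sum_eq_single j, cofactor_into_self]
  · intro l _ hl
    rw [← cofactor_vertex_smul, vertex_smul_into_of_ne σ hl.symm, map_zero]
  · simp

variable (k d) in
/-- The matrices of the endomorphism of the top of `P(d)` induced by an endomorphism of `P(d)`. -/
def topMatrix : (ProjModule k V d →ₗ[PathAlgebra k V] ProjModule k V d) →ₗ[k]
    (∀ i, Matrix (Fin (d i)) (Fin (d i)) k) where
  toFun θ := fun i => Matrix.of fun t s => coeff k d i t (θ (gen k d i s))
  map_add' θ η := by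
    funext i
    ext t s
    exact map_add (coeff k d i t) _ _
  map_smul' c θ := by
    funext i
    ext t s
    exact map_smul (coeff k d i t) _ _

theorem topMatrix_apply (θ : ProjModule k V d →ₗ[PathAlgebra k V] ProjModule k V d) (i : V)
    (t s : Fin (d i)) : topMatrix k d θ i t s = coeff k d i t (θ (gen k d i s)) := rfl

theorem coeff_of_topMatrix_eq_zero {θ : ProjModule k V d →ₗ[PathAlgebra k V] ProjModule k V d}
    (hθ : topMatrix k d θ = 0) (l : V) (t : Fin (d l)) : coeff k d l t (θ x) = 0 := by
  conv_lhs => rw [← sum_smul_gen x]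
  simp only [map_sum, map_smul, coeff_smul]
  refine Finset.sum_eq_zero fun m _ => Finset.sum_eq_zero fun s _ => ?_
  by_cases h : m = l
  · subst h
    rw [← topMatrix_apply, hθ]
    exact mul_zero _
  · rw [nilCoeff_of_ne x h, zero_mul]

/-- A scalar matrix at each vertex already acts on the copies of `kΔ e_i` and induces itself on the
top. -/
theorem topMatrix_surjective : Function.Surjective (topMatrix (V := V) k d) := by
  intro T
  refine ⟨⟨⟨fun x i t => ∑ s, T i t s • x i s, fun x y => ?_⟩, fun a x => ?_⟩, ?_⟩
  · funext i t
    simp [Finset.sum_add_distrib]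
  · funext i t
    simp [Finset.smul_sum, smul_comm a]
  · funext i
    ext t s
    rw [topMatrix_apply, coeff_apply]
    change nilCoeff i ((∑ r, T i t r • gen k d i s i r :
      Submodule.span (PathAlgebra k V) {vertex k i}) : PathAlgebra k V) = _
    rw [Finset.sum_eq_single s, Submodule.coe_smul_of_tower, gen_self, map_smul,
      nilCoeff_vertex_self, smul_eq_mul, mul_one]
    · intro r _ hr
      rw [gen_of_ne i hr, smul_zero]
    · simp

theorem topMatrix_total (σ : StarMaps k V (ProjModule k V d) (ProjModule k V d)) :
    topMatrix k d (total σ) = 0 := by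
  funext i
  ext t s
  rw [topMatrix_apply, total_apply, map_sum]
  refine Finset.sum_eq_zero fun j _ => ?_
  rw [into, map_sum]
  refine Finset.sum_eq_zero fun h _ => ?_
  rw [map_sum]
  refine Finset.sum_eq_zero fun b _ => ?_
  rw [coeff_smul, arrow, Quiver.Hom.toPath, nilCoeff_cons, zero_mul]

/-- The family of cofactors of an endomorphism which vanishes on the top of `P(d)`. -/
def cofactors {θ : ProjModule k V d →ₗ[PathAlgebra k V] ProjModule k V d}
    (hθ : topMatrix k d θ = 0) : StarMaps k V (ProjModule k V d) (ProjModule k V d) :=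
  ⟨fun _ _ a => cofactor a ∘ₗ θ.restrictScalars k, by
    refine ⟨fun i j a x => ?_, fun i j a x => ?_, fun i j a x => ?_, fun i h j a b hab x => ?_⟩ <;>
      simp only [LinearMap.comp_apply, LinearMap.restrictScalars_apply, map_smul]
    · exact vertex_smul_cofactor a _
    · exact cofactor_vertex_smul a _
    · rw [cofactor_arrow_smul_self]
      -- Expand `θ x` by its last arrows; applying `e_i` keeps exactly the arrows that end at `i`,
      -- as the commutation relation requires.
      conv_lhs => rw [← eq_sum_cofactor (θ x) fun i s => coeff_of_topMatrix_eq_zero x hθ i s]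
      rw [Finset.smul_sum, Finset.sum_eq_single i]
      · simp only [Finset.smul_sum, ← mul_smul, vertex_mul_arrow]
      · intro l _ hl
        simp only [Finset.smul_sum, ← mul_smul, vertex_mul_arrow_of_ne _ hl.symm, zero_smul,
          Finset.sum_const_zero]
      · simp
    · rw [cofactor_arrow_smul_of_ne]
      rintro ⟨⟩
      exact hab rfl⟩

variable (k d) in
/-- Families of star maps on `P(d)` correspond to the endomorphisms of `P(d)` which vanish on
the top. -/
def starMapsEquiv : StarMaps k V (ProjModule k V d) (ProjModule k V d) ≃ₗ[k]
    LinearMap.ker (topMatrix (V := V) k d) where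
  toLinearMap := total.codRestrict _ fun σ => LinearMap.mem_ker.2 (topMatrix_total σ)
  invFun θ := cofactors (LinearMap.mem_ker.1 θ.2)
  left_inv σ := by
    apply StarMaps.ext
    intro i j a x
    exact cofactor_total a x σ
  right_inv θ := by
    apply Subtype.ext
    apply LinearMap.ext
    intro x
    exact eq_sum_cofactor (θ.1 x) fun i s =>
      coeff_of_topMatrix_eq_zero x (LinearMap.mem_ker.1 θ.2) i s

variable (k) in
theorem finite_end (acyclic : ∀ (i : V) (p : Quiver.Path i i), p = Quiver.Path.nil) (d : V → ℕ) :
    Module.Finite k (ProjModule k V d →ₗ[PathAlgebra k V] ProjModule k V d) := by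
  have := finite_projModule (k := k) acyclic d
  exact Module.Finite.of_injective
    (LinearMap.restrictScalarsₗ k (PathAlgebra k V) (ProjModule k V d) (ProjModule k V d) k)
    (LinearMap.restrictScalars_injective k)

-- Rank-nullity for `topMatrix`: its range is all tuples of matrices, and its kernel is `StarMaps`.
variable (k) in
theorem finrank_end (acyclic : ∀ (i : V) (p : Quiver.Path i i), p = Quiver.Path.nil)
    (d : V → ℕ) :
    Module.finrank k (ProjModule k V d →ₗ[PathAlgebra k V] ProjModule k V d) =
      ∑ i, d i ^ 2 +
        Module.finrank k (StarMaps k V (ProjModule k V d) (ProjModule k V d)) := by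
  have := finite_end k acyclic d
  rw [(starMapsEquiv k d).finrank_eq, ← (topMatrix (V := V) k d).finrank_range_add_finrank_ker,
    LinearMap.range_eq_top.2 topMatrix_surjective, finrank_top, Module.finrank_pi_fintype]
  simp [Module.finrank_matrix, sq]

end ProjModule

end Dimension

/-! ### Vanishing of `Ext^1` in terms of split extensions and extendable maps -/

section ExtOne

variable {R : Type v} [Ring R] {X Y E : Type v} [AddCommGroup X] [Module R X]
  [AddCommGroup Y] [Module R Y] [AddCommGroup E] [Module R E]

open Abelian

/-- If `Ext^1(X, Y) = 0`, then every extension of `X` by `Y` splits. -/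
theorem exists_section_of_subsingleton_ext
    (h : Subsingleton (Ext (ModuleCat.of R X) (ModuleCat.of R Y) 1))
    (i : Y →ₗ[R] E) (p : E →ₗ[R] X) (hi : Function.Injective i) (hp : Function.Surjective p)
    (hip : Function.Exact i p) : ∃ s : X →ₗ[R] E, p ∘ₗ s = LinearMap.id := by
  let S := ModuleCat.shortComplexOfCompEqZero i p hip.linearMap_comp_eq_zero
  have hS : S.ShortExact := ModuleCat.shortComplex_shortExact S hip hi hp
  -- The connecting map sends the identity of `X` into `Ext^1(X, Y) = 0`, so the identity lifts to a
  -- map `X → E`.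
  obtain ⟨x, hx⟩ := Ext.covariant_sequence_exact₃ (ModuleCat.of R X) hS
    (Ext.mk₀ (𝟙 (ModuleCat.of R X))) (zero_add 1) (Subsingleton.elim (α := Ext
      (ModuleCat.of R X) (ModuleCat.of R Y) 1) _ _)
  obtain ⟨s, rfl⟩ := (Ext.mk₀_bijective _ _).2 x
  rw [Ext.mk₀_comp_mk₀] at hx
  have := (Ext.mk₀_bijective _ _).1 hx
  exact ⟨s.hom, congrArg ModuleCat.Hom.hom this⟩

/-- If every homomorphism from the kernel of a surjection of a projective module onto `X` extends
to the projective module, then `Ext^1(X, Y) = 0`. -/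
theorem subsingleton_ext_of_extension [Module.Projective R E] (p : E →ₗ[R] X)
    (hp : Function.Surjective p)
    (h : ∀ f : LinearMap.ker p →ₗ[R] Y, ∃ g : E →ₗ[R] Y, g ∘ₗ (LinearMap.ker p).subtype = f) :
    Subsingleton (Ext (ModuleCat.of R X) (ModuleCat.of R Y) 1) := by
  refine subsingleton_of_forall_eq 0 fun e => ?_
  have hS := LinearMap.shortExact_shortComplexKer hp
  have : Projective p.shortComplexKer.X₂ := ModuleCat.projective_of_categoryTheory_projective _
  -- The pullback of `e` to the projective `E` vanishes, so `e` is the connecting image of a map `f`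
  -- on the kernel. An extension of `f` to `E` makes this image zero.
  obtain ⟨x, rfl⟩ := Ext.contravariant_sequence_exact₃ hS (ModuleCat.of R Y) e
    (Ext.eq_zero_of_projective _) (add_zero 1)
  obtain ⟨f, rfl⟩ := (Ext.mk₀_bijective _ _).2 x
  obtain ⟨g, hg⟩ := h f.hom
  have hf : f = p.shortComplexKer.f ≫ ModuleCat.ofHom g := by
    ext x
    exact (LinearMap.congr_fun hg x).symm
  rw [hf, ← Ext.mk₀_comp_mk₀, ShortComplex.ShortExact.extClass_comp_assoc]

end ExtOne

/-! ### Rigidity as surjectivity of the commutator map -/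

section Rigid

open PathAlgebra

variable {k : Type u} [Field k] {V : Type v} [Quiver.{w} V] [Fintype V]
  [∀ i j : V, Fintype (i ⟶ j)]

namespace StarMaps

variable {M : Type*} [AddCommGroup M] [Module k M] [Module (PathAlgebra k V) M]
  [IsScalarTower k (PathAlgebra k V) M]

/-- The `D`-module given by a family of star maps. -/
def Mod (_ : StarMaps k V M M) : Type _ := M

variable (σ : StarMaps k V M M)

instance : AddCommGroup (Mod σ) := inferInstanceAs (AddCommGroup M)

instance : Module (DoubleAlgebra k V) (Mod σ) := Module.compHom M (lift σ).toRingHom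

/-- The identity, as a map to the `D`-module given by a family of star maps. -/
def toMod : M ≃+ Mod σ := AddEquiv.refl M

theorem path_smul_toMod (a : PathAlgebra k V) (x : M) :
    ofPathAlgebra k V a • toMod σ x = toMod σ (a • x) := lift_ofPathAlgebra σ a x

theorem star_smul_toMod {i j : V} (a : i ⟶ j) (x : M) :
    star (k := k) a • toMod σ x = toMod σ (σ.1 i j a x) :=
  LinearMap.congr_fun (lift_star σ a) x

/-- The extension of a `D`-module by itself given by a second family of star maps. -/
def extension (η : StarMaps k V M M) : StarMaps k V (M × M) (M × M) :=
  postcomp (LinearMap.inl _ _ _) (precomp σ (LinearMap.fst _ _ _)) +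
    postcomp (LinearMap.inr _ _ _) (precomp σ (LinearMap.snd _ _ _)) +
    postcomp (LinearMap.inl _ _ _) (precomp η (LinearMap.snd _ _ _))

theorem extension_apply (η : StarMaps k V M M) {i j : V} (a : i ⟶ j) (x : M × M) :
    (extension σ η).1 i j a x = (σ.1 i j a x.1 + η.1 i j a x.2, σ.1 i j a x.2) := by
  change ((σ.1 i j a x.1, (0 : M)) + ((0 : M), σ.1 i j a x.2)) + (η.1 i j a x.2, (0 : M)) = _
  simp

end StarMaps

/-- A map of `D`-modules which is additive and commutes with the actions of `kV` and of the
elements `a^*` is `D`-linear. -/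
def linearOfGenerators {M N : Type*} [AddCommGroup M] [Module (DoubleAlgebra k V) M]
    [AddCommGroup N] [Module (DoubleAlgebra k V) N] (f : M →+ N)
    (hp : ∀ (a : PathAlgebra k V) x, f (ofPathAlgebra k V a • x) = ofPathAlgebra k V a • f x)
    (hs : ∀ (i j : V) (a : i ⟶ j) x, f (star (k := k) a • x) = star (k := k) a • f x) :
    M →ₗ[DoubleAlgebra k V] N where
  toFun := f
  map_add' := f.map_add
  map_smul' := mem_of_ofPathAlgebra_of_star
    { carrier := {a | ∀ x, f (a • x) = a • f x}
      mul_mem' := fun {a b} ha hb x => by rw [mul_smul, ha, hb, mul_smul]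
      add_mem' := fun {a b} ha hb x => by rw [add_smul, map_add, ha, hb, add_smul]
      algebraMap_mem' := fun c x => by
        rw [← (ofPathAlgebra k V).commutes, hp] } hp hs

section Extensions

variable {M N : Type (max u v w)} [AddCommGroup M] [Module k M] [Module (PathAlgebra k V) M]
  [IsScalarTower k (PathAlgebra k V) M] [AddCommGroup N] [Module k N]
  [Module (DoubleAlgebra k V) N] [IsScalarTower k (DoubleAlgebra k V) N]
  (σ₀ : StarMaps k V M M) (e : M ≃ₗ[k] N)

/-- A family `η` defines on `M × M` the upper triangular structure with diagonal `σ₀` and corner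
`η`. A `D`-linear splitting `x ↦ (g x, x)` satisfies `g σ₀ = σ₀ g + η`, so `η` is the commutator of
`-g`. -/
theorem delta_surjective_of_subsingleton_ext
    (he : ∀ (a : PathAlgebra k V) x, ofPathAlgebra k V a • e x = e (a • x))
    (hes : ∀ (i j : V) (a : i ⟶ j) x, star (k := k) a • e x = e (σ₀.1 i j a x))
    (h : Subsingleton (Abelian.Ext (ModuleCat.of (DoubleAlgebra k V) N)
      (ModuleCat.of (DoubleAlgebra k V) N) 1)) :
    Function.Surjective (StarMaps.delta σ₀ σ₀) := by
  intro η
  let σ := StarMaps.extension σ₀ η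
  let e' := StarMaps.toMod σ
  let i : N →ₗ[DoubleAlgebra k V] StarMaps.Mod σ := linearOfGenerators
    (e'.toAddMonoidHom.comp ((AddMonoidHom.inl _ _).comp e.symm.toLinearMap.toAddMonoidHom))
    (fun a x => by
      obtain ⟨x, rfl⟩ := e.surjective x
      simp [e', he, StarMaps.path_smul_toMod])
    (fun i j a x => by
      obtain ⟨x, rfl⟩ := e.surjective x
      simp [e', hes, StarMaps.star_smul_toMod, σ, StarMaps.extension_apply])
  let p : StarMaps.Mod σ →ₗ[DoubleAlgebra k V] N := linearOfGenerators
    (e.toLinearMap.toAddMonoidHom.comp ((AddMonoidHom.snd _ _).comp e'.symm.toAddMonoidHom))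
    (fun a x => by
      obtain ⟨x, rfl⟩ := e'.surjective x
      simp [e', he, StarMaps.path_smul_toMod])
    (fun i j a x => by
      obtain ⟨x, rfl⟩ := e'.surjective x
      simp [e', hes, StarMaps.star_smul_toMod, σ, StarMaps.extension_apply])
  have hi (x) : i (e x) = e' (x, 0) :=
    congrArg (fun z => e' (z, 0)) (e.symm_apply_apply x)
  have hp (x) : p (e' x) = e x.2 := rfl
  obtain ⟨s, hs⟩ := exists_section_of_subsingleton_ext h i p
    (fun x y hxy => by
      obtain ⟨x, rfl⟩ := e.surjective x
      obtain ⟨y, rfl⟩ := e.surjective y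
      rw [hi, hi] at hxy
      exact congrArg (fun z => e z.1) (e'.injective hxy))
    (fun x => ⟨e' (0, e.symm x), by rw [hp]; exact e.apply_symm_apply x⟩)
    (fun x => by
      obtain ⟨x, rfl⟩ := e'.surjective x
      refine ⟨fun hx => ⟨e x.1, ?_⟩, ?_⟩
      · rw [hp, map_eq_zero_iff e e.injective] at hx
        rw [hi, ← hx]
      · rintro ⟨y, hy⟩
        obtain ⟨y, rfl⟩ := e.surjective y
        rw [← hy, hi, hp, map_zero])
  have hs2 (x : M) : (e'.symm (s (e x))).2 = x :=
    e.injective (LinearMap.congr_fun hs (e x))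
  have hs' (x : M) : s (e x) = e' (e'.symm (s (e x))) :=
    (e'.apply_symm_apply _).symm
  let g : M →ₗ[PathAlgebra k V] M :=
    { toFun := fun x => (e'.symm (s (e x))).1
      map_add' := fun x y => by rw [map_add, map_add, map_add, Prod.fst_add]
      map_smul' := fun a x => by
        rw [← he, map_smul, hs', StarMaps.path_smul_toMod, e'.symm_apply_apply,
          Prod.smul_fst, RingHom.id_apply, ← hs'] }
  have hg (x) : g x = (e'.symm (s (e x))).1 := rfl
  refine ⟨-g, ?_⟩
  apply StarMaps.ext
  intro i j a x
  have h2 : g (σ₀.1 i j a x) = σ₀.1 i j a (g x) + η.1 i j a x := by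
    rw [hg, ← hes, map_smul, hs', StarMaps.star_smul_toMod, e'.symm_apply_apply,
      StarMaps.extension_apply, hs2, hg]
  rw [StarMaps.delta_apply, LinearMap.neg_apply, LinearMap.neg_apply, map_neg, h2]
  abel

/-- If the commutator map is surjective, then homomorphisms to the module extend from the kernel of a
surjection onto it, provided that this
surjection splits over `kV`. -/
theorem exists_extension
    (he : ∀ (a : PathAlgebra k V) x, ofPathAlgebra k V a • e x = e (a • x))
    (hes : ∀ (i j : V) (a : i ⟶ j) x, star (k := k) a • e x = e (σ₀.1 i j a x))
    (h : Function.Surjective (StarMaps.delta σ₀ σ₀)) {Q : Type*}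
    [AddCommGroup Q] [Module k Q] [Module (DoubleAlgebra k V) Q]
    [IsScalarTower k (DoubleAlgebra k V) Q] (p : Q →ₗ[DoubleAlgebra k V] N)
    (s : M →ₗ[k] Q) (hs : ∀ (a : PathAlgebra k V) x, s (a • x) = ofPathAlgebra k V a • s x)
    (hps : ∀ x, p (s x) = e x) (f : LinearMap.ker p →ₗ[DoubleAlgebra k V] N) :
    ∃ g : Q →ₗ[DoubleAlgebra k V] N, g ∘ₗ (LinearMap.ker p).subtype = f := by
  -- `T` measures the failure of the `kΔ`-section `s` to commute with `a^*`. It lands in the kernel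
  -- since `p ∘ s` is the `D`-structure map `e`. Applying `f` gives a star family on `M`, which by
  -- hypothesis is a commutator.
  let T (i j : V) (a : i ⟶ j) : M →ₗ[k] LinearMap.ker p :=
    { toFun := fun x => ⟨star (k := k) a • s x - s (σ₀.1 i j a x), by
        rw [LinearMap.mem_ker, map_sub, map_smul, hps, hps, hes, sub_self]⟩
      map_add' := fun x y => by
        apply Subtype.ext
        simp only [map_add, smul_add, Submodule.coe_add]
        abel
      map_smul' := fun c x => by
        apply Subtype.ext
        simp only [map_smul, RingHom.id_apply, Submodule.coe_smul_of_tower, smul_sub]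
        rw [smul_comm] }
  have hT (i j : V) (a : i ⟶ j) (x) :
      (T i j a x : Q) = star (k := k) a • s x - s (σ₀.1 i j a x) := rfl
  have hX (a : PathAlgebra k V) (y : LinearMap.ker p) :
      e.symm (f (ofPathAlgebra k V a • y)) = a • e.symm (f y) := by
    rw [map_smul]
    apply e.injective
    rw [e.apply_symm_apply, ← he]
    exact congrArg _ (e.apply_symm_apply _).symm
  let η : StarMaps k V (M) (M) :=
    ⟨fun i j a => e.symm.toLinearMap ∘ₗ f.restrictScalars k ∘ₗ T i j a, by
      refine ⟨fun i j a x => ?_, fun i j a x => ?_, fun i j a x => ?_,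
        fun i h j a b hab x => ?_⟩ <;>
      simp only [LinearMap.comp_apply, LinearMap.restrictScalars_apply, LinearEquiv.coe_coe]
      · rw [← hX]
        congr 2
        apply Subtype.ext
        rw [Submodule.coe_smul, hT, smul_sub, ← mul_smul, vertex_mul_star, ← hs,
          StarMaps.vertex_smul]
      · congr 2
        apply Subtype.ext
        rw [hT, hT, hs, ← mul_smul, star_mul_vertex, StarMaps.apply_vertex_smul]
      · simp only [← hX, ← map_sum]
        congr 2
        apply Subtype.ext
        simp only [hT, hs, ← mul_smul, star_mul_arrow_self, StarMaps.apply_arrow_smul, map_sum,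
          Finset.sum_smul, Submodule.coe_sum, Submodule.coe_smul, smul_sub,
          Finset.sum_sub_distrib]
      · have : T i j a (arrow k b • x) = 0 := by
          apply Subtype.ext
          rw [hT, hs, ← mul_smul, star_mul_arrow_of_ne _ _ hab, zero_smul,
            StarMaps.apply_arrow_smul_of_ne _ _ _ hab, map_zero, sub_zero]
          rfl
        rw [this, map_zero, map_zero]⟩
  obtain ⟨g, hg⟩ := h η
  have hg (i j : V) (a : i ⟶ j) (x : M) :
      f (T i j a x) = e (σ₀.1 i j a (g x)) - e (g (σ₀.1 i j a x)) := by
    rw [← map_sub, ← StarMaps.delta_apply, hg]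
    exact (e.apply_symm_apply _).symm
  -- The retraction onto the kernel complementary to `s`; it commutes with `kΔ` but in general not
  -- with the `a^*`.
  let r : Q →+ LinearMap.ker p :=
    { toFun := fun y => ⟨y - s (e.symm (p y)), by
        rw [LinearMap.mem_ker, map_sub, hps, e.apply_symm_apply, sub_self]⟩
      map_zero' := by
        apply Subtype.ext
        simp
      map_add' := fun y z => by
        apply Subtype.ext
        simp only [map_add, Submodule.coe_add]
        abel }
  have hr (y : Q) : (r y : Q) = y - s (e.symm (p y)) := rfl
  have hep (a : PathAlgebra k V) (y : Q) :
      e.symm (p (ofPathAlgebra k V a • y)) = a • e.symm (p y) := by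
    rw [map_smul]
    apply e.injective
    rw [e.apply_symm_apply, ← he]
    exact congrArg _ (e.apply_symm_apply _).symm
  have hps' (i j : V) (a : i ⟶ j) (y : Q) :
      e.symm (p (star (k := k) a • y)) = σ₀.1 i j a (e.symm (p y)) := by
    rw [map_smul]
    apply e.injective
    rw [e.apply_symm_apply, ← hes]
    exact congrArg _ (e.apply_symm_apply _).symm
  let G : Q →+ N := e.toLinearMap.toAddMonoidHom.comp (g.toAddMonoidHom.comp
    (e.symm.toLinearMap.toAddMonoidHom.comp p.toAddMonoidHom))
  have hG (y : Q) : G y = e (g (e.symm (p y))) := rfl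
  have hGp (a : PathAlgebra k V) (y : Q) :
      G (ofPathAlgebra k V a • y) = ofPathAlgebra k V a • G y := by
    rw [hG, hep, map_smul, hG, he]
  have hGs (i j : V) (a : i ⟶ j) (y : Q) :
      G (star (k := k) a • y) = e (g (σ₀.1 i j a (e.symm (p y)))) := by
    rw [hG, hps']
  -- The defect of `f ∘ r` at `a^*` is `f ∘ T`, evaluated at `e⁻¹ p y`. By the choice of `g`, the
  -- term `G` has the opposite defect, and it vanishes on the kernel of `p`.
  refine ⟨linearOfGenerators (f.toAddMonoidHom.comp r + G) (fun a y => ?_)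
    (fun i j a y => ?_), ?_⟩
  · have h1 : r (ofPathAlgebra k V a • y) = ofPathAlgebra k V a • r y := Subtype.ext (by
      rw [Submodule.coe_smul, hr, hr, smul_sub, hep, hs])
    simp only [AddMonoidHom.add_apply, AddMonoidHom.comp_apply, LinearMap.toAddMonoidHom_coe, h1,
      hGp, map_smul, smul_add]
  · have h1 : r (star (k := k) a • y) = star (k := k) a • r y + T i j a (e.symm (p y)) :=
      Subtype.ext (by
        rw [Submodule.coe_add, Submodule.coe_smul, hr, hr, hT, smul_sub, hps']
        abel)
    simp only [AddMonoidHom.add_apply, AddMonoidHom.comp_apply, LinearMap.toAddMonoidHom_coe, h1,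
      hGs, map_add, map_smul, smul_add, hg]
    rw [add_assoc, sub_add_cancel, hG, hes]
  · ext y
    change f (r y) + e (g (e.symm (p y))) = f y
    have h0 : p y = 0 := y.2
    have h1 : r y = y := Subtype.ext (by rw [hr, h0, map_zero, map_zero, sub_zero])
    rw [h1, h0, map_zero, map_zero, map_zero, add_zero]

end Extensions

namespace Rep

variable {d : V → ℕ} (X : Rep k V d)

/-- The identity, as a map from `P(d)` to the `D`-module given by a point of `Rep(D, P(d))`. -/
def toMod : ProjModule k V d ≃ₗ[k] X.Mod := LinearEquiv.refl k _

theorem path_smul_toMod (a : PathAlgebra k V) (x : ProjModule k V d) :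
    ofPathAlgebra k V a • X.toMod x = X.toMod (a • x) := X.restrict a x

theorem star_smul_toMod {i j : V} (a : i ⟶ j) (x : ProjModule k V d) :
    star (k := k) a • X.toMod x = X.toMod (X.stars.1 i j a x) := rfl

/-- Surjections onto `X` split over `kV`. -/
theorem exists_path_section {Q : Type*}
    [AddCommGroup Q] [Module k Q] [Module (DoubleAlgebra k V) Q]
    [IsScalarTower k (DoubleAlgebra k V) Q] (p : Q →ₗ[DoubleAlgebra k V] X.Mod)
    (hp : Function.Surjective p) : ∃ s : ProjModule k V d →ₗ[k] Q,
      (∀ (a : PathAlgebra k V) x, s (a • x) = ofPathAlgebra k V a • s x) ∧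
      ∀ x, p (s x) = X.toMod x := by
  -- The lifts of the generators need not be fixed by `e_i`: the coordinate `x i s` lies in `kΔ
  -- e_i`, so it may be applied to any lift.
  choose q hq using fun (i : V) (s : Fin (d i)) => hp (X.toMod (ProjModule.gen k d i s))
  let s : ProjModule k V d →ₗ[k] Q :=
    { toFun := fun x => ∑ i, ∑ s, ofPathAlgebra k V (x i s) • q i s
      map_add' := fun x y => by
        simp only [Pi.add_apply, Submodule.coe_add, map_add, add_smul, Finset.sum_add_distrib]
      map_smul' := fun c x => by
        simp only [Pi.smul_apply, Submodule.coe_smul_of_tower, map_smul, smul_assoc,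
          Finset.smul_sum, RingHom.id_apply] }
  have hs (a : PathAlgebra k V) (x : ProjModule k V d) :
      s (a • x) = ofPathAlgebra k V a • s x := by
    change ∑ i, ∑ s, ofPathAlgebra k V ((a • x) i s : PathAlgebra k V) • q i s =
      ofPathAlgebra k V a • ∑ i, ∑ s, ofPathAlgebra k V (x i s) • q i s
    simp only [ProjModule.coe_smul, map_mul, mul_smul, Finset.smul_sum]
  have hps (x : ProjModule k V d) : p (s x) = X.toMod x := by
    conv_rhs => rw [← ProjModule.sum_smul_gen x]
    change p (∑ i, ∑ s, ofPathAlgebra k V (x i s) • q i s) = _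
    simp only [map_sum, map_smul, hq, path_smul_toMod]
  exact ⟨s, hs, hps⟩

/-- For the converse, the free `D`-module on the set `X` is the projective cover term: its
surjection onto `X` splits over `kΔ`, so `exists_extension` applies. -/
theorem isRigid_iff_delta_surjective :
    X.IsRigid ↔ Function.Surjective (StarMaps.delta X.stars X.stars) := by
  refine ⟨delta_surjective_of_subsingleton_ext X.stars X.toMod X.path_smul_toMod
    fun _ _ => X.star_smul_toMod, fun h => ?_⟩
  refine subsingleton_ext_of_extension
    (Finsupp.linearCombination (DoubleAlgebra k V) (id : X.Mod → X.Mod))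
    (Finsupp.linearCombination_id_surjective _ _) fun f => ?_
  obtain ⟨s, hs, hps⟩ := X.exists_path_section _
    (Finsupp.linearCombination_id_surjective (DoubleAlgebra k V) X.Mod)
  exact exists_extension X.stars X.toMod X.path_smul_toMod (fun _ _ => X.star_smul_toMod) h _ s
    hs hps f

end Rep

end Rigid

/-! ### The dimension of `End_D X` by rank-nullity -/

section EndDimension

theorem finrank_ker_of_finrank_eq {k E F : Type*} [Field k] [AddCommGroup E] [Module k E]
    [AddCommGroup F] [Module k F] [Module.Finite k E] [Module.Finite k F] (f : E →ₗ[k] F) {n : ℕ}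
    (h : Module.finrank k E = n + Module.finrank k F) :
    n ≤ Module.finrank k (LinearMap.ker f) ∧
      (Function.Surjective f ↔ Module.finrank k (LinearMap.ker f) = n) := by
  have h1 := LinearMap.finrank_range_add_finrank_ker f
  have h2 := Submodule.finrank_le (LinearMap.range f)
  refine ⟨by omega, ?_⟩
  rw [← LinearMap.range_eq_top]
  refine ⟨fun hs => ?_, fun he => Submodule.eq_top_of_finrank_eq (by omega)⟩
  rw [hs, finrank_top] at h1
  omega

variable {k : Type u} [Field k] {V : Type v} [Quiver.{w} V] [Fintype V]
  [∀ i j : V, Fintype (i ⟶ j)] {d : V → ℕ}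

theorem finite_starMaps (acyclic : ∀ (i : V) (p : Quiver.Path i i), p = Quiver.Path.nil)
    (d : V → ℕ) : Module.Finite k (StarMaps k V (ProjModule k V d) (ProjModule k V d)) := by
  have := ProjModule.finite_end k acyclic d
  exact Module.Finite.equiv (ProjModule.starMapsEquiv k d).symm

namespace Rep

variable (X : Rep k V d)

theorem finrank_endD (acyclic : ∀ (i : V) (p : Quiver.Path i i), p = Quiver.Path.nil) :
    ∑ i, d i ^ 2 ≤ Module.finrank k X.EndD ∧
      (Function.Surjective (StarMaps.delta X.stars X.stars) ↔
        Module.finrank k X.EndD = ∑ i, d i ^ 2) := by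
  have := ProjModule.finite_end k acyclic d
  have := finite_starMaps (k := k) acyclic d
  have h := finrank_ker_of_finrank_eq (StarMaps.delta X.stars X.stars)
    (ProjModule.finrank_end k acyclic d)
  have h2 := X.endEquiv.finrank_eq
  exact ⟨h.1.trans h2.ge, h.2.trans ⟨fun e => h2.trans e, fun e => h2.symm.trans e⟩⟩

end Rep

end EndDimension

/-! ### Ranks in a pencil of linear maps -/

section Pencil

variable {k : Type*} [Field k] {E F : Type*} [AddCommGroup E] [Module k E]
  [AddCommGroup F] [Module k F]

/-- Linear independence is an open condition along a line. -/
theorem finite_not_linearIndependent {ι : Type*} [Finite ι] (u v : ι → F)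
    (hu : LinearIndependent k u) : {t : k | ¬ LinearIndependent k (u + t • v)}.Finite := by
  classical
  have := Fintype.ofFinite ι
  obtain ⟨p, hp⟩ := (Fintype.linearCombination k u).exists_leftInverse_of_injective
    (LinearMap.ker_eq_bot.2 (linearIndependent_iff_injective_fintypeLinearCombination.1 hu))
  have hpu (i : ι) : p (u i) = Pi.single i 1 := by
    have := LinearMap.congr_fun hp (Pi.single i 1)
    rwa [LinearMap.comp_apply, Fintype.linearCombination_apply_single, one_smul] at this
  -- In the coordinates given by `p`, the vectors `u + t v` are the rows of `1 + t N`. The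
  -- determinant is a polynomial in `t` with value `1` at `0`, hence has finitely many roots.
  let N : Matrix ι ι k := Matrix.of fun i => p (v i)
  let P : Polynomial k := (1 + (Polynomial.X : Polynomial k) • N.map Polynomial.C).det
  have hP (t : k) : P.eval t = (1 + t • N).det := by
    rw [← Polynomial.coe_evalRingHom, RingHom.map_det]
    congr 1
    ext i j
    by_cases h : i = j <;> simp [h] <;> exact mul_comm _ _
  have hP0 : P ≠ 0 := by
    intro h
    have := hP 0
    rw [h] at this
    simp at this
  refine (Polynomial.finite_setOfPred_isRoot hP0).subset fun t ht => ?_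
  by_contra hroot
  rw [Set.mem_ofPred_eq, Polynomial.IsRoot, hP] at hroot
  refine ht (LinearIndependent.of_comp p ?_)
  have h := Matrix.linearIndependent_rows_of_det_ne_zero hroot
  have hrow : p ∘ (u + t • v) = fun i => (1 + t • N) i := by
    funext i j
    simp [hpu, N, Matrix.one_apply, Pi.single_apply, eq_comm]
  rw [hrow]
  exact h

/-- If the rank of a pencil of linear maps at infinitely many points is not larger than its rank at
zero, then the derivative maps the kernel at zero to the range at zero. -/
theorem mem_range_of_pencil [Module.Finite k F] (A B : E →ₗ[k] F)
    (h : {t : k | Module.finrank k (LinearMap.range (A + t • B)) ≤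
      Module.finrank k (LinearMap.range A)}.Infinite) {v : E} (hv : A v = 0) :
    B v ∈ LinearMap.range A := by
  by_contra hB
  let b := Module.finBasis k (LinearMap.range A)
  choose w hw using fun i => (b i).2
  -- If `B v` were outside the range of `A`, these `rank A + 1` vectors would be independent. For `t
  -- ≠ 0` the first is `(A + tB)(t⁻¹ v)` because `A v = 0`, and the others deform to `(A + tB) w_i`.
  -- So `A + tB` has larger rank for all but finitely many `t`.
  have hli : LinearIndependent k (Fin.cons (B v) (A ∘ w) : Fin (_ + 1) → F) := by
    have hAw : A ∘ w = (LinearMap.range A).subtype ∘ b := funext hw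
    rw [linearIndependent_finCons, hAw]
    refine ⟨b.linearIndependent.map' _ (Submodule.ker_subtype _), fun hmem => hB ?_⟩
    refine Submodule.span_le.2 ?_ hmem
    rintro _ ⟨i, rfl⟩
    exact (b i).2
  have hfin := (finite_not_linearIndependent _ (Fin.cons 0 (B ∘ w) : Fin (_ + 1) → F) hli).union
    (Set.finite_singleton (0 : k))
  obtain ⟨t, ht, htn⟩ := (h.sdiff hfin).nonempty
  simp only [Set.mem_union, Set.mem_ofPred_eq, Set.mem_singleton_iff, not_or, not_not] at htn
  obtain ⟨hlt, ht0⟩ := htn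
  have hmem (i) : (Fin.cons (B v) (A ∘ w) + t • (Fin.cons 0 (B ∘ w) : Fin (_ + 1) → F) : Fin (_ + 1) → F) i ∈
      LinearMap.range (A + t • B) := by
    refine Fin.cases ⟨t⁻¹ • v, ?_⟩ (fun i => ⟨w i, ?_⟩) i
    · simp [hv, smul_smul, ht0]
    · simp
  have hli' : LinearIndependent k fun i => (⟨_, hmem i⟩ : LinearMap.range (A + t • B)) :=
    LinearIndependent.of_comp (LinearMap.range (A + t • B)).subtype hlt
  have := hli'.fintype_card_le_finrank
  rw [Fintype.card_fin] at this
  have ht' : Module.finrank k (LinearMap.range (A + t • B)) ≤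
    Module.finrank k (LinearMap.range A) := ht
  omega

end Pencil

/-! ### Polynomial functions, lines in Zariski open sets, and polynomial families of kernel vectors
-/

section Zariski

variable {k : Type u} [Field k] {U : Type v} [AddCommGroup U] [Module k U]

theorem dual_mem_polynomialFunctions (ξ : Module.Dual k U) :
    (fun y => ξ y) ∈ polynomialFunctions k U :=
  Algebra.subset_adjoin ⟨ξ, rfl⟩

theorem const_mem_polynomialFunctions (c : k) :
    (fun _ => c) ∈ polynomialFunctions k U :=
  (polynomialFunctions k U).algebraMap_mem c

theorem comp_mem_polynomialFunctions {W : Type*} [AddCommGroup W] [Module k W] (l : U →ₗ[k] W)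
    {f : W → k} (hf : f ∈ polynomialFunctions k W) : f ∘ l ∈ polynomialFunctions k U := by
  induction hf using Algebra.adjoin_induction with
  | mem f hf =>
    obtain ⟨ξ, rfl⟩ := hf
    exact dual_mem_polynomialFunctions (ξ ∘ₗ l)
  | algebraMap c => exact const_mem_polynomialFunctions c
  | add f g _ _ hf hg => exact add_mem hf hg
  | mul f g _ _ hf hg => exact mul_mem hf hg

theorem exists_polynomial_on_line {f : U → k} (hf : f ∈ polynomialFunctions k U) (y z : U) :
    ∃ p : Polynomial k, ∀ t : k, f (y + t • z) = p.eval t := by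
  induction hf using Algebra.adjoin_induction with
  | mem f hf =>
    obtain ⟨ξ, rfl⟩ := hf
    exact ⟨Polynomial.C (ξ y) + Polynomial.X * Polynomial.C (ξ z), fun t => by
      simp only [map_add, map_smul, smul_eq_mul, Polynomial.eval_add, Polynomial.eval_mul,
        Polynomial.eval_C, Polynomial.eval_X]⟩
  | algebraMap c => exact ⟨Polynomial.C c, fun t => by simp⟩
  | add f g _ _ hf hg =>
    obtain ⟨p, hp⟩ := hf
    obtain ⟨q, hq⟩ := hg
    exact ⟨p + q, fun t => by simp [hp, hq]⟩
  | mul f g _ _ hf hg =>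
    obtain ⟨p, hp⟩ := hf
    obtain ⟨q, hq⟩ := hg
    exact ⟨p * q, fun t => by simp [hp, hq]⟩

/-- A line through a point of a Zariski open set leaves this set at finitely many points only. -/
theorem finite_line_not_mem {W : Set U} (hW : @IsOpen U (zariskiTopology k U) W) {y : U} (hy : y ∈ W)
    (z : U) : {t : k | y + t • z ∉ W}.Finite := by
  have hW' : TopologicalSpace.GenerateOpen
    {W | ∃ f ∈ polynomialFunctions k U, W = {x | f x ≠ 0}} W := hW
  clear hW
  induction hW' with
  | basic W hW =>
    obtain ⟨f, hf, rfl⟩ := hW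
    obtain ⟨p, hp⟩ := exists_polynomial_on_line hf y z
    have hp0 : p ≠ 0 := by
      rintro rfl
      have := hp 0
      rw [zero_smul, add_zero, Polynomial.eval_zero] at this
      exact hy this
    refine (Polynomial.finite_setOfPred_isRoot hp0).subset fun t ht => ?_
    have ht : f (y + t • z) = 0 := not_not.1 ht
    rwa [hp] at ht
  | univ => simp
  | inter W W' _ _ h h' =>
    refine ((h hy.1).union (h' hy.2)).subset fun t ht => ?_
    by_contra hn
    simp only [Set.mem_union, Set.mem_ofPred_eq, not_or, not_not] at hn
    exact ht hn
  | sUnion S _ h =>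
    obtain ⟨W, hW, hyW⟩ := hy
    exact (h W hW hyW).subset fun t ht hn => ht ⟨W, hW, hn⟩

/-- Evaluation of polynomial functions at a point. -/
def evalPolynomial (y : U) : polynomialFunctions k U →+* k :=
  (Pi.evalRingHom (fun _ => k) y).comp (polynomialFunctions k U).val.toRingHom

theorem evalPolynomial_apply (y : U) (f : polynomialFunctions k U) :
    evalPolynomial y f = f.1 y := rfl

variable {E F : Type*} [AddCommGroup E] [Module k E] [AddCommGroup F] [Module k F]

/-- The determinant of a polynomial family of endomorphisms is a polynomial function. -/
theorem det_mem_polynomialFunctions [Module.Finite k F] (g : U → E)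
    (hg : ∀ ξ : Module.Dual k E, (fun y => ξ (g y)) ∈ polynomialFunctions k U)
    (l : E →ₗ[k] Module.End k F) :
    (fun y => LinearMap.det (l (g y))) ∈ polynomialFunctions k U := by
  let b := Module.finBasis k F
  -- Taking the entries in the ring of polynomial functions makes the determinant polynomial at
  -- once.
  let N : Matrix _ _ (polynomialFunctions k U) :=
    Matrix.of fun i j => ⟨fun y => b.coord i (l (g y) (b j)),
      hg (b.coord i ∘ₗ LinearMap.applyₗ (b j) ∘ₗ l)⟩
  have h : (fun y => LinearMap.det (l (g y))) = N.det.1 := by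
    funext y
    rw [← evalPolynomial_apply, RingHom.map_det, ← LinearMap.det_toMatrix b]
    congr 1
    ext i j
    simp [N, evalPolynomial_apply, LinearMap.toMatrix_apply]
  rw [h]
  exact N.det.2

theorem map_adjugate_mulVec {R S n : Type*} [CommRing R] [CommRing S] [Fintype n]
    [DecidableEq n] (f : R →+* S) (N : Matrix n n R) (r : n → R) :
    f ∘ Matrix.mulVec N.adjugate r = Matrix.mulVec (N.map f).adjugate (f ∘ r) := by
  funext i
  rw [Function.comp_apply, RingHom.map_mulVec]
  exact congrArg (fun A => Matrix.mulVec A (f ∘ r) i) (RingHom.map_adjugate f N)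

/-- A vector in the kernel of a surjective member of an affine family of linear maps
extends to a polynomial family of vectors in the kernels. -/
theorem exists_polynomial_kernel [Module.Finite k F] (L : U →ₗ[k] E →ₗ[k] F) (c : E →ₗ[k] F)
    (y₀ : U) (hs : Function.Surjective (L y₀ + c)) (v : E) (hv : (L y₀ + c) v = 0) :
    ∃ g : U → E, (∀ y, (L y + c) (g y) = 0) ∧ g y₀ = v ∧
      ∀ ξ : Module.Dual k E, (fun y => ξ (g y)) ∈ polynomialFunctions k U := by
  obtain ⟨s, hs⟩ := (L y₀ + c).exists_rightInverse_of_surjective (LinearMap.range_eq_top.2 hs)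
  let b := Module.finBasis k F
  have haff (i) (x : E) : (fun y => b.coord i ((L y + c) x)) ∈ polynomialFunctions k U := by
    have : (fun y => b.coord i ((L y + c) x)) =
        (fun y => (b.coord i ∘ₗ L.flip x) y) + fun _ => b.coord i (c x) := by
      funext y
      simp
    rw [this]
    exact add_mem (dual_mem_polynomialFunctions _) (const_mem_polynomialFunctions _)
  -- `N` is the matrix of `(L y + c) ∘ s`, where `s` is a section at `y₀`. Cramer's rule without
  -- division gives the kernel vector `det N • v - s (adj N · (L y + c) v)`. At `y₀`, `N = 1` and
  -- the correction vanishes, so its value there is `v`.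
  let N : Matrix _ _ (polynomialFunctions k U) := Matrix.of fun i j => ⟨_, haff i (s (b j))⟩
  let r : _ → polynomialFunctions k U := fun i => ⟨_, haff i v⟩
  let w := Matrix.mulVec N.adjugate r
  let z (y : U) : F := ∑ i, (w i).1 y • b i
  have hN (y : U) : N.map (evalPolynomial y) = LinearMap.toMatrix b b ((L y + c) ∘ₗ s) := by
    ext i j
    simp [N, evalPolynomial_apply, LinearMap.toMatrix_apply]
  have hr (y : U) : evalPolynomial y ∘ r = b.repr ((L y + c) v) := by
    funext i
    simp [r, evalPolynomial_apply]
  have hdet (y : U) : N.det.1 y = (N.map (evalPolynomial y)).det := by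
    rw [← evalPolynomial_apply]
    exact RingHom.map_det _ _
  have hz (y : U) : b.repr (z y) =
      Matrix.mulVec (N.map (evalPolynomial y)).adjugate (b.repr ((L y + c) v)) := by
    have h1 : b.repr (z y) = evalPolynomial y ∘ w := by
      funext i
      simp only [z, map_sum, map_smul, Module.Basis.repr_self, Finsupp.coe_finsetSum,
        Finset.sum_apply, Finsupp.coe_smul, Pi.smul_apply, Finsupp.single_apply, smul_eq_mul]
      simp [evalPolynomial_apply]
    rw [h1, ← hr]
    exact map_adjugate_mulVec (evalPolynomial y) N r
  refine ⟨fun y => N.det.1 y • v - s (z y), fun y => ?_, ?_, fun ξ => ?_⟩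
  · have h : (L y + c) (s (z y)) = N.det.1 y • (L y + c) v := by
      apply b.repr.injective
      apply DFunLike.coe_injective
      have h1 := LinearMap.toMatrix_mulVec_repr b b ((L y + c) ∘ₗ s) (z y)
      rw [LinearMap.comp_apply] at h1
      rw [← h1, ← hN, hz, Matrix.mulVec_mulVec, Matrix.mul_adjugate, ← hdet, Matrix.smul_mulVec,
        Matrix.one_mulVec, map_smul, Finsupp.coe_smul]
    rw [map_sub, map_smul, h, sub_self]
  · have h1 : N.det.1 y₀ = 1 := by
      rw [hdet, hN, hs, LinearMap.toMatrix_id, Matrix.det_one]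
    have h2 : z y₀ = 0 := by
      apply b.repr.injective
      apply DFunLike.coe_injective
      rw [hz, hv, map_zero]
      exact Matrix.mulVec_zero _
    change N.det.1 y₀ • v - s (z y₀) = v
    rw [h1, h2, one_smul, map_zero, sub_zero]
  · have h : (fun y => ξ (N.det.1 y • v - s (z y))) =
        N.det.1 * (fun _ => ξ v) - ∑ i, (w i).1 * fun _ => ξ (s (b i)) := by
      funext y
      simp [z]
    rw [h]
    exact sub_mem (mul_mem N.det.2 (const_mem_polynomialFunctions _))
      (sum_mem fun i _ => mul_mem (w i).2 (const_mem_polynomialFunctions _))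

end Zariski

/-! ### Open orbits and surjectivity of the commutator map -/

section Orbit

variable {k : Type u} [Field k] {V : Type v} [Quiver.{w} V] [Fintype V]
  [∀ i j : V, Fintype (i ⟶ j)]

namespace StarMaps

variable {M : Type*} [AddCommGroup M] [Module k M] [Module (PathAlgebra k V) M]
  [IsScalarTower k (PathAlgebra k V) M] (σ τ η : StarMaps k V M M)

/-- Two families of star maps on `M` are conjugate under an automorphism of `M`. -/
def Conj : Prop :=
  ∃ g : M ≃ₗ[PathAlgebra k V] M, ∀ (i j : V) (a : i ⟶ j) (x : M),
    τ.1 i j a (g x) = g (σ.1 i j a x)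

variable {σ τ}

/-- Substituting `h = g (g⁻¹ h)` and moving `g` past `τ` turns `delta σ τ` into `delta σ σ` followed
by `g`. So conjugate points do not raise the rank. -/
theorem delta_eq_postcomp {g : M ≃ₗ[PathAlgebra k V] M}
    (hg : ∀ (i j : V) (a : i ⟶ j) (x : M), τ.1 i j a (g x) = g (σ.1 i j a x))
    (h : M →ₗ[PathAlgebra k V] M) :
    delta σ τ h = postcomp g.toLinearMap (delta σ σ (g.symm.toLinearMap ∘ₗ h)) := by
  apply StarMaps.ext
  intro i j a x
  rw [delta_apply, postcomp_apply, delta_apply, LinearEquiv.coe_coe, map_sub, ← hg]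
  simp

variable (k V M) in
/-- Composition on the left, as a linear map. -/
def postcompLin (g : M →ₗ[PathAlgebra k V] M) : StarMaps k V M M →ₗ[k] StarMaps k V M M where
  toFun := postcomp g
  map_add' σ τ := by
    apply StarMaps.ext
    intro i j a x
    exact g.map_add _ _
  map_smul' c σ := by
    apply StarMaps.ext
    intro i j a x
    exact g.map_smul_of_tower c _

/-- Composition on the right, as a linear map. -/
def precompLin : (M →ₗ[PathAlgebra k V] M) →ₗ[k] StarMaps k V M M where
  toFun g := precomp η g
  map_add' g h := by
    apply StarMaps.ext
    intro i j a x
    exact (η.1 i j a).map_add _ _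
  map_smul' c g := by
    apply StarMaps.ext
    intro i j a x
    exact (η.1 i j a).map_smul c _

theorem Conj.finrank_range_delta_le [Module.Finite k (StarMaps k V M M)] (h : Conj σ τ) :
    Module.finrank k (LinearMap.range (delta σ τ)) ≤
      Module.finrank k (LinearMap.range (delta σ σ)) := by
  obtain ⟨g, hg⟩ := h
  refine le_trans (Submodule.finrank_mono (t := (LinearMap.range (delta σ σ)).map
    (postcompLin k V M g.toLinearMap)) ?_) (Submodule.finrank_map_le _ _)
  rintro _ ⟨h, rfl⟩
  rw [delta_eq_postcomp hg]
  exact ⟨_, ⟨_, rfl⟩, rfl⟩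

theorem Conj.delta_surjective (h : Conj σ τ) (hs : Function.Surjective (delta σ σ)) :
    Function.Surjective (delta τ τ) := by
  obtain ⟨g, hg⟩ := h
  intro η
  obtain ⟨f, hf⟩ := hs (postcomp g.symm.toLinearMap (precomp η g.toLinearMap))
  refine ⟨g.toLinearMap ∘ₗ f ∘ₗ g.symm.toLinearMap, ?_⟩
  apply StarMaps.ext
  intro i j a x
  obtain ⟨x, rfl⟩ := g.surjective x
  have h1 := congrArg (fun ρ : StarMaps k V M M => g (ρ.1 i j a x)) hf
  simp only [delta_apply, postcomp_apply, precomp_apply, LinearEquiv.coe_coe, map_sub,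
    LinearEquiv.apply_symm_apply] at h1
  rw [delta_apply, ← h1]
  simp [hg]

/-- The point with parameter `t` on the line through `σ` with direction `η`. -/
def line (σ η : StarMaps k V M M) (t : k) : StarMaps k V M M := σ + t • η

theorem delta_line (σ η : StarMaps k V M M) (t : k) :
    delta σ (line σ η t) = delta σ σ + t • precompLin η := by
  apply LinearMap.ext
  intro g
  apply StarMaps.ext
  intro i j a x
  exact add_sub_right_comm (σ.1 i j a (g x)) (t • η.1 i j a (g x)) (g (σ.1 i j a x))

/-- If infinitely many points of each line through `σ` are conjugate to `σ`, then the commutator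
map of `σ` is surjective. -/
theorem delta_surjective_of_infinite [Module.Finite k (StarMaps k V M M)]
    (h : ∀ η : StarMaps k V M M, {t : k | Conj σ (line σ η t)}.Infinite) :
    Function.Surjective (delta σ σ) := by
  intro η
  -- The identity lies in the kernel at `t = 0`, and the derivative of the pencil sends it to `η`.
  have h1 := mem_range_of_pencil (delta σ σ) (precompLin η)
    ((h η).mono fun t ht => by
      have := Conj.finrank_range_delta_le (Set.mem_ofPred_eq.mp ht)
      rwa [delta_line] at this) (v := LinearMap.id) (by
        apply StarMaps.ext
        intro i j a x
        exact sub_self _)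
  exact h1

/-- If the commutator map of `σ` is surjective, then all points of a Zariski neighbourhood of `σ`
are conjugate to `σ`. -/
theorem exists_polynomial_conj [Module.Finite k (StarMaps k V M M)] [Module.Finite k M]
    (hs : Function.Surjective (delta σ σ)) :
    ∃ f ∈ polynomialFunctions k (∀ i j : V, (i ⟶ j) → (M →ₗ[k] M)),
      f σ.1 ≠ 0 ∧ ∀ τ : StarMaps k V M M, f τ.1 ≠ 0 → Conj σ τ := by
  -- Polynomial functions live on all tuples of linear maps, while `delta σ τ` is defined only for
  -- star families. A linear retraction `r` onto `StarMaps` extends `τ ↦ delta σ τ` to an affine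
  -- family on the ambient space.
  obtain ⟨r, hr⟩ := (StarMaps k V M M).subtype.exists_leftInverse_of_injective
    (Submodule.ker_subtype _)
  let L : (∀ i j : V, (i ⟶ j) → (M →ₗ[k] M)) →ₗ[k] (M →ₗ[PathAlgebra k V] M) →ₗ[k]
      (∀ i j : V, (i ⟶ j) → (M →ₗ[k] M)) :=
    LinearMap.mk₂ k (fun y g => fun i j a => y i j a ∘ₗ g.restrictScalars k)
      (fun y y' g => rfl) (fun c y g => rfl)
      (fun y g g' => by
        funext i j a
        exact LinearMap.ext fun x => (y i j a).map_add _ _)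
      (fun c y g => by
        funext i j a
        exact LinearMap.ext fun x => (y i j a).map_smul c _)
  -- The constant term `delta σ σ - precompLin σ` is `g ↦ -g σ`.
  have hL (τ : StarMaps k V M M) : L.compr₂ r τ.1 + (delta σ σ - precompLin σ) = delta σ τ := by
    apply LinearMap.ext
    intro g
    have h1 : r (L τ.1 g) = precomp τ g := LinearMap.congr_fun hr (precomp τ g)
    rw [LinearMap.add_apply, LinearMap.compr₂_apply, h1]
    apply StarMaps.ext
    intro i j a x
    change τ.1 i j a (g x) + (σ.1 i j a (g x) - g (σ.1 i j a x) - σ.1 i j a (g x)) =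
      τ.1 i j a (g x) - g (σ.1 i j a x)
    abel
  obtain ⟨g, hg, hg1, hgp⟩ := exists_polynomial_kernel (L.compr₂ r) (delta σ σ - precompLin σ) σ.1
    (by rwa [hL]) LinearMap.id (by
      rw [hL]
      apply StarMaps.ext
      intro i j a x
      exact sub_self _)
  refine ⟨_, det_mem_polynomialFunctions g hgp
    (LinearMap.restrictScalarsₗ k (PathAlgebra k V) M M k), ?_, fun τ hτ => ?_⟩
  · rw [hg1]
    have : LinearMap.restrictScalarsₗ k (PathAlgebra k V) M M k LinearMap.id = LinearMap.id := rfl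
    rw [this, LinearMap.det_id]
    exact one_ne_zero
  · have hb : Function.Bijective (g τ.1) :=
      ((LinearMap.restrictScalarsₗ k (PathAlgebra k V) M M k (g τ.1)).equivOfDetNeZero hτ).bijective
    refine ⟨LinearEquiv.ofBijective (g τ.1) hb, fun i j a x => ?_⟩
    have h1 := hg τ.1
    rw [hL] at h1
    exact sub_eq_zero.1 (congrArg (fun ρ : StarMaps k V M M => ρ.1 i j a x) h1)

end StarMaps

namespace Rep

variable {d : V → ℕ}

theorem mem_orbit_iff (X Y : Rep k V d) :
    Y ∈ MulAction.orbit (AutGroup k V d) X ↔ StarMaps.Conj X.stars Y.stars := by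
  constructor
  · rintro ⟨g, rfl⟩
    refine ⟨g, fun i j a x => ?_⟩
    refine (stars_smul g X a (g x)).trans ?_
    rw [LinearEquiv.symm_apply_apply]
  · rintro ⟨g, hg⟩
    refine ⟨g, stars_injective ?_⟩
    apply StarMaps.ext
    intro i j a x
    refine (stars_smul g X a x).trans ?_
    rw [← hg, LinearEquiv.apply_symm_apply]

variable (k V d) in
/-- The coordinates of the elements `a^*` in the ambient space of `Rep(D, P(d))`. -/
def ambientStars : Ambient k V d →ₗ[k]
    (∀ i j : V, (i ⟶ j) → (ProjModule k V d →ₗ[k] ProjModule k V d)) where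
  toFun y := fun i j a => y j i (Sum.inr a)
  map_add' _ _ := rfl
  map_smul' _ _ := rfl

/-- The vector of the ambient space given by a family of star maps. -/
def direction (η : StarMaps k V (ProjModule k V d) (ProjModule k V d)) : Ambient k V d
  | _, _, Sum.inl _ => 0
  | _, _, Sum.inr a => η.1 _ _ a

/-- The coordinates of the arrows of `Δ` are fixed by the `kΔ`-structure, so a line of star families
is a line in the ambient space. -/
theorem coords_ofStars (X : Rep k V d)
    (η : StarMaps k V (ProjModule k V d) (ProjModule k V d)) (t : k) :
    (ofStars (StarMaps.line X.stars η t)).coords = X.coords + t • direction η := by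
  have h (Y : Rep k V d) {i j : V} (a : i ⟶ j) (x : ProjModule k V d) :
      Y.coords (i := i) (j := j) (Sum.inl a) x = PathAlgebra.arrow k a • x := by
    rw [← Y.restrict, ofPathAlgebra_arrow]
    rfl
  funext i j a
  apply LinearMap.ext
  intro x
  rcases a with a | a
  · refine (h _ a x).trans ((h X a x).symm.trans ?_)
    change _ = X.coords i j (Sum.inl a) x + t • (0 : ProjModule k V d)
    rw [smul_zero, add_zero]
  · exact congrArg (fun τ : StarMaps k V (ProjModule k V d) (ProjModule k V d) => τ.1 j i a x)
      (stars_ofStars (StarMaps.line X.stars η t))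

theorem delta_surjective_of_isOpen_orbit [Infinite k]
    (acyclic : ∀ (i : V) (p : Quiver.Path i i), p = Quiver.Path.nil) (X : Rep k V d)
    (h : IsOpen (MulAction.orbit (AutGroup k V d) X)) :
    Function.Surjective (StarMaps.delta X.stars X.stars) := by
  have := finite_starMaps (k := k) acyclic d
  let := zariskiTopology k (Ambient k V d)
  obtain ⟨W, hW, hWX⟩ := isOpen_induced_iff.1 h
  refine StarMaps.delta_surjective_of_infinite fun η => ?_
  have hX : X.coords ∈ W := by
    have : X ∈ coords ⁻¹' W := hWX ▸ MulAction.mem_orbit_self X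
    exact this
  -- Over an infinite field, the cofinite set of parameters at which the line stays in the open set
  -- is infinite.
  refine (Set.Finite.infinite_compl (finite_line_not_mem hW hX (direction η))).mono
    fun t ht => ?_
  have ht : X.coords + t • direction η ∈ W := not_not.1 ht
  rw [← coords_ofStars] at ht
  have h1 : ofStars (StarMaps.line X.stars η t) ∈ MulAction.orbit (AutGroup k V d) X := hWX ▸ ht
  rw [mem_orbit_iff, stars_ofStars] at h1
  exact h1

theorem isOpen_orbit_of_delta_surjective
    (acyclic : ∀ (i : V) (p : Quiver.Path i i), p = Quiver.Path.nil) (X : Rep k V d)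
    (h : Function.Surjective (StarMaps.delta X.stars X.stars)) :
    IsOpen (MulAction.orbit (AutGroup k V d) X) := by
  have := finite_starMaps (k := k) acyclic d
  have := finite_projModule (k := k) acyclic d
  rw [isOpen_iff_forall_mem_open]
  intro Y hY
  -- Surjectivity passes to every conjugate `Y` of `X`, so the neighbourhood can be constructed
  -- around `Y` itself.
  obtain ⟨f, hf, hfY, hfc⟩ := StarMaps.exists_polynomial_conj
    (((mem_orbit_iff X Y).1 hY).delta_surjective h)
  refine ⟨coords ⁻¹' {y | (f ∘ ambientStars k V d) y ≠ 0}, fun Z hZ => ?_, ?_, hfY⟩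
  · rw [← MulAction.orbit_eq_iff.2 hY, mem_orbit_iff]
    exact hfc Z.stars hZ
  · let := zariskiTopology k (Ambient k V d)
    exact isOpen_induced (TopologicalSpace.isOpen_generateFrom_of_mem
      ⟨_, comp_mem_polynomialFunctions (ambientStars k V d) hf, rfl⟩)

end Rep

end Orbit

end QuiverDouble

end

theorem mainTheorem3 {k : Type u} [Field k] [Infinite k]
    {V : Type v} [Quiver.{w} V] [Fintype V] [∀ i j : V, Fintype (i ⟶ j)]
    (acyclic : ∀ (i : V) (p : Quiver.Path i i), p = Quiver.Path.nil)
    (d : V → ℕ) (X : QuiverDouble.Rep k V d) :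
    ∑ i, d i ^ 2 ≤ Module.finrank k X.EndD ∧
    List.TFAE
      [IsOpen (MulAction.orbit (QuiverDouble.AutGroup k V d) X),
        X.IsRigid,
        Module.finrank k X.EndD = ∑ i, d i ^ 2] := by
  obtain ⟨hle, hiff⟩ := X.finrank_endD acyclic
  refine ⟨hle, ?_⟩
  tfae_have 1 ↔ 3 := Iff.trans ⟨X.delta_surjective_of_isOpen_orbit acyclic,
    X.isOpen_orbit_of_delta_surjective acyclic⟩ hiff
  tfae_have 2 ↔ 3 := X.isRigid_iff_delta_surjective.trans hiff
  tfae_finish
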